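/- **Setting.** Let $n\ge 2$, $d\ge 1$, and let $f_1,\dots,f_n:\mathbb R^d\to\mathbb R$ be differentiable with $\|\nabla f_i(x)-\nabla f_i(y)\|\le \ell\|x-y\|$ for all $x,y$ ($\ell>0$). Put $f=\frac1n\sum_i f_i$, assume $f^*=\inf f>-\infty$ and the Polyak–Łojasiewicz condition $\frac12\|\nabla f(x)\|^2\ge\nu(f(x)-f^*)$ for all $x$ ($\nu>0$). Let $A\in\mathbb R^{n\times n}$ be the symmetric nonnegative weighted adjacency matrix of a connected undirected graph on $\{1,\dots,n\}$, $L=\mathrm{diag}(\sum_jA_{ij})-A$ its Laplacian, $\rho$ the spectral radius and $\rho_2$ the smallest positive eigenvalue of $L$. Let $\mathcal C:\mathbb R^d\to\mathbb R^d$ be a locally-bounded compressor: for some $p\in[1,\infty]$, $r>0$, $C>0$, $\delta\in(0,1]$, $\|\mathcal C(x)/r-x\|_p\le C(1-\delta)$ whenever $\|x\|_p\le C$. Here $\|\cdot\|=\|\cdot\|_2$. Put $\hat d=d^{1/p-1/2}$, $\tilde d=1$ if $p\le2$, and $\hat d=1$, $\tilde d=d^{1/2-1/p}$ if $p>2$.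 **Algorithm.** Given $\alpha,\beta,\gamma,\omega>0$, positive scalars $s_k$ and $x_{i,0}\in\mathbb R^d$, start from $v_{i,0}=\hat x_{i,-1}=y_{i,-1}=0$ and for $k\ge0$ and all $i$ put $$q_{i,k}=\mathcal C\big((x_{i,k}-\hat x_{i,k-1})/s_k\big),\quad \hat x_{i,k}=\hat x_{i,k-1}+\omega s_kq_{i,k},\quad y_{i,k}=y_{i,k-1}+\omega s_k\sum_jL_{ij}q_{j,k},$$ $$x_{i,k+1}=x_{i,k}-\alpha(\beta y_{i,k}+\gamma v_{i,k}+\nabla f_i(x_{i,k})),\quad v_{i,k+1}=v_{i,k}+\alpha\gamma y_{i,k}.$$ Write $\bar x_k=\frac1n\sum_ix_{i,k}$. **Constants.** Let $\beta=\tau_1\gamma$, $\kappa_1=4/\rho_2$, $$\kappa_2=\max\Big\{2+2\ell^2,\tfrac5{\rho_2},\sqrt[3]{\tfrac{16\ell^2(\kappa_1+1)^2}{\rho_2}},\tfrac{2\sqrt2\,\ell}{\rho_2}\Big\},\qquad \kappa_2'=\max\Big\{2+3\ell^2,\tfrac5{\rho_2},\sqrt[3]{\tfrac{16\ell^2(\tau_1+1)^2}{\rho_2}},\tfrac{2\sqrt2\,\ell}{\rho_2}\Big\},$$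 $\varphi_1=\frac12(\rho_2\beta-(3\gamma+2+3\ell^2))$, $\varphi_2=3\rho^2\beta^2-\rho_2\beta\gamma+(\rho+2)\gamma^2+1+\frac52\ell^2$, $\varphi_3=\frac\gamma2-\frac5{2\rho_2}$, $\varphi_4=2\rho\gamma^2+\frac12\rho$, $\varphi_5=\frac18-\frac{(\beta+\gamma)^2\ell^2}{\gamma^5\rho_2}-\frac{\ell^2}{2\gamma^2\rho_2^2}$, $\varphi_6=\frac{(\beta+\gamma)\ell^2}{2\gamma^3\rho_2}+\frac{\ell^2}{2\gamma^2\rho_2^2}+\frac{\ell^2}{2\rho_2^2}+\frac{\ell^2}2+\frac\ell2$, $\varphi_7=(\rho+1)\gamma+\frac12\rho\beta$, $\varphi_8=3\rho^2\beta^2+(\rho-2\rho_2)\beta\gamma+(\rho+2)\gamma^2+1$; $\varepsilon_1=\frac{\tau_1\rho_2-1}{2\tau_1\rho_2}$, $\varepsilon_2=\max\{\frac{1+\tau_1\rho_2}2,\frac{1+\tau_1}2+\frac1{2\tau_1\rho_2^2}\}$, $\varepsilon_3(\alpha)=\min\{\varphi_1-\alpha\varphi_2,\varphi_3-\alpha\varphi_4\}$,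 $\varepsilon_5=\omega r(\delta-\delta^2/2)$, $\varepsilon_6(\alpha)=\min\{\nu/2,\varepsilon_3(\alpha)\}/\varepsilon_2$; $\psi_2(\alpha)=\varphi_7+\alpha\varphi_8$, $\psi_3=4(1+\varepsilon_5^{-1})\hat d^2\beta^2\rho^2$, $\psi_4=4(1+\varepsilon_5^{-1})\hat d^2\max\{\beta^2\rho^2+\ell^2,\gamma^2\rho\}/\varepsilon_1$; $\hat\kappa_0=\min\{\varphi_1/\varphi_2,\varphi_3/\varphi_4,\varphi_5/\varphi_6\}$, $\kappa_5\in(0,+\infty]$ the smallest positive root $t$ of $t\,\varepsilon_3(t)=1$ ($+\infty$ if there is none), and for $\psi_5\in\mathbb R$ $$\kappa_0'(\psi_5)=\min\Big\{\hat\kappa_0,\kappa_5,\tfrac1{\sqrt n\,\tilde d}\sqrt{\tfrac{\varepsilon_5+2\varepsilon_5^2}{(1-2\varepsilon_5)\psi_3+\psi_4\psi_5}}\Big\}.$$ Call $(\alpha,\psi_5)$ admissible if $0<\alpha<\kappa_0'(\psi_5)$ and $\psi_5>(1-2\varepsilon_5)\psi_2(\alpha)/\varepsilon_6(\alpha)$.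 Let $$\kappa_9=\sqrt{1-\alpha\big(\varepsilon_6(\alpha)-(1-2\varepsilon_5)\psi_2(\alpha)/\psi_5\big)},\quad \kappa_{10}=\sqrt{1-(\varepsilon_5+2\varepsilon_5^2)+\alpha^2n\tilde d^2\big((1-2\varepsilon_5)\psi_3+\psi_4\psi_5\big)}.$$ Let $J=\frac1n\mathbf 1\mathbf 1^\top$, $E=I_n-J$, $F=(L+\lambda J)^{-1}$ for a fixed $\lambda\in[\rho_2,\rho]$, $\boldsymbol E=E\otimes I_d$, $\boldsymbol F=F\otimes I_d$, $\boldsymbol x_0=\mathrm{col}(x_{1,0},\dots,x_{n,0})$, $\boldsymbol w=\frac1\gamma\mathrm{col}(\nabla f_1(\bar x_0),\dots,\nabla f_n(\bar x_0))$ and $$\kappa_\nu=\tfrac12\boldsymbol x_0^\top\boldsymbol E\boldsymbol x_0+\tfrac{\beta+\gamma}{2\gamma}\boldsymbol w^\top\boldsymbol F\boldsymbol w+\boldsymbol x_0^\top\boldsymbol E\boldsymbol F\boldsymbol w+\tfrac n{2\nu}\|\nabla f(\bar x_0)\|^2 .$$ **Theorem.** Let $\tau_1>\kappa_1$, $\gamma>\kappa_2$,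 $\beta=\tau_1\gamma$ and $\omega\in(0,1/r]$. 1. If $\gamma>\kappa_2'$, then there are $\psi_5$ and $\bar\alpha>0$ such that $(\alpha,\psi_5)$ is admissible for every $\alpha\in(0,\bar\alpha)$. 2. Let $(\alpha,\psi_5)$ be admissible. Then $\max\{\kappa_9,\kappa_{10}\}<1$. Moreover, for every $\epsilon\in(\max\{\kappa_9,\kappa_{10}\},1)$, all initial points $x_{i,0}$, every $\lambda\in[\rho_2,\rho]$ and every $s_0>0$ with $$s_0\ge\max\Big\{\sqrt{\tfrac{\kappa_\nu}{n\tilde d^2\psi_5C^2}},\ \tfrac{\max_i\|x_{i,0}\|_p}{C}\Big\},$$ the algorithm run with $s_k=s_0\epsilon^k$ satisfies $$f(\bar x_k)-f^*+\frac1n\sum_{i=1}^n\|x_{i,k}-\bar x_k\|^2=\mathcal O(\epsilon^{2k})\qquad(k\to\infty).$$ -/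

import Mathlib

open scoped ENNReal

noncomputable section

namespace UnifiedCompression

/-- The decision space `ℝ^d` with its Euclidean norm. -/
abbrev Vec (d : ℕ) : Type := EuclideanSpace ℝ (Fin d)

/-- The `ℓ_p` norm on `ℝ^d`, for `1 ≤ p ≤ ∞`. -/
def lpNorm {d : ℕ} (p : ℝ≥0∞) (x : Vec d) : ℝ := ‖WithLp.toLp p (WithLp.ofLp x)‖

/-- All the data of the problem and the fixed gains of the algorithm. This is plain data;
the assumptions on it are the separate predicates below. -/
structure Setting (n d : ℕ) where
  /-- weighted adjacency matrix of the communication graph -/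
  A : Matrix (Fin n) (Fin n) ℝ
  /-- local cost functions -/
  f : Fin n → Vec d → ℝ
  /-- the compressor -/
  comp : Vec d → Vec d
  /-- exponent of the norm in the compressor bound -/
  p : ℝ≥0∞
  /-- scaling of the compressor -/
  r : ℝ
  /-- radius of the local region -/
  C : ℝ
  /-- contraction of the compressor -/
  δ : ℝ
  /-- smoothness constant of the local costs -/
  ℓ : ℝ
  /-- Polyak–Łojasiewicz constant -/
  ν : ℝ
  /-- ratio `β / γ` -/
  τ₁ : ℝ
  γ : ℝ
  ω : ℝ

namespace Setting

variable {n d : ℕ} (S : Setting n d)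

/-! ### Assumptions -/

/-- Locally-bounded compressor. -/
structure LocallyBounded : Prop where
  one_le_p : 1 ≤ S.p
  r_pos : 0 < S.r
  C_pos : 0 < S.C
  δ_pos : 0 < S.δ
  δ_le : S.δ ≤ 1
  bound : ∀ x : Vec d, lpNorm S.p x ≤ S.C →
    lpNorm S.p (S.r⁻¹ • S.comp x - x) ≤ S.C * (1 - S.δ)

/-- The weighted graph is undirected and connected. -/
structure UndirectedConnected : Prop where
  nonneg : ∀ i j, 0 ≤ S.A i j
  symm : ∀ i j, S.A i j = S.A j i
  connected : (SimpleGraph.fromRel fun i j => 0 < S.A i j).Connected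

/-- Every local cost is differentiable with `ℓ`-Lipschitz gradient. -/
structure Smooth : Prop where
  ℓ_pos : 0 < S.ℓ
  differentiable : ∀ i, Differentiable ℝ (S.f i)
  lipschitz : ∀ i x y, ‖gradient (S.f i) x - gradient (S.f i) y‖ ≤ S.ℓ * ‖x - y‖

/-- The global cost `f = (1/n) ∑ f_i`. -/
def F (x : Vec d) : ℝ := (1 / (n : ℝ)) * ∑ i, S.f i x

/-- The optimal value is finite. -/
def FiniteOptimum : Prop := BddBelow (Set.range S.F)

/-- The optimal value `f* = inf f`. -/
def fStar : ℝ := ⨅ x, S.F x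

/-- Polyak–Łojasiewicz condition with constant `ν`. -/
structure PolyakLojasiewicz : Prop where
  ν_pos : 0 < S.ν
  bound : ∀ x, (1 / 2 : ℝ) * ‖gradient S.F x‖ ^ 2 ≥ S.ν * (S.F x - S.fStar)

/-! ### The algorithm -/

/-- Graph Laplacian `L = D - A`. -/
def L : Matrix (Fin n) (Fin n) ℝ := Matrix.diagonal (fun i => ∑ j, S.A i j) - S.A

def β : ℝ := S.τ₁ * S.γ

/-- State before iteration `k`: `x = x_k`, `v = v_k`, `xhat = x̂_{k-1}`, `y = y_{k-1}`. -/
structure State (n d : ℕ) where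
  x : Fin n → Vec d
  v : Fin n → Vec d
  xhat : Fin n → Vec d
  y : Fin n → Vec d

/-- One iteration with stepsize `α` and scaling factor `s = s_k`. -/
def step (α s : ℝ) (z : State n d) : State n d :=
  let q : Fin n → Vec d := fun i => S.comp (s⁻¹ • (z.x i - z.xhat i))
  let y : Fin n → Vec d := fun i => z.y i + (S.ω * s) • ∑ j, S.L i j • q j
  { x := fun i => z.x i - α • (S.β • y i + S.γ • z.v i + gradient (S.f i) (z.x i))
    v := fun i => z.v i + (α * S.γ) • y i
    xhat := fun i => z.xhat i + (S.ω * s) • q i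
    y := y }

/-- The run of the algorithm with stepsize `α`, scaling sequence `s`, initial points `x₀`. -/
def run (α : ℝ) (s : ℕ → ℝ) (x₀ : Fin n → Vec d) : ℕ → State n d
  | 0 => { x := x₀, v := 0, xhat := 0, y := 0 }
  | k + 1 => S.step α (s k) (run α s x₀ k)

/-- Average of the agents' points. -/
def avg (x : Fin n → Vec d) : Vec d := (1 / (n : ℝ)) • ∑ i, x i

/-- `f(x̄) - f* + (1/n) ∑ ‖x_i - x̄‖²`. -/
def gap (x : Fin n → Vec d) : ℝ :=
  S.F (avg x) - S.fStar + (1 / (n : ℝ)) * ∑ i, ‖x i - avg x‖ ^ 2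

/-! ### Constants -/

/-- Spectral radius of the Laplacian. -/
def ρ : ℝ := (spectralRadius ℝ S.L).toReal

/-- Smallest positive eigenvalue of the Laplacian. -/
def ρ₂ : ℝ := sInf {μ : ℝ | μ ∈ spectrum ℝ S.L ∧ 0 < μ}

/-- `‖x‖_p ≤ dHat * ‖x‖`; here `1 / ∞ = 0`. -/
def dHat : ℝ := if S.p ≤ 2 then (d : ℝ) ^ (1 / S.p.toReal - 1 / 2) else 1

/-- `‖x‖ ≤ dTilde * ‖x‖_p`; here `1 / ∞ = 0`. -/
def dTilde : ℝ := if S.p ≤ 2 then 1 else (d : ℝ) ^ (1 / 2 - 1 / S.p.toReal)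

def κ₁ : ℝ := 4 / S.ρ₂

def κ₂ : ℝ :=
  max (max (2 + 2 * S.ℓ ^ 2) (5 / S.ρ₂))
    (max ((16 * S.ℓ ^ 2 * (S.κ₁ + 1) ^ 2 / S.ρ₂) ^ (1 / 3 : ℝ)) (2 * √2 * S.ℓ / S.ρ₂))

/-- The threshold on `γ` above which the stepsize range is certainly nonempty. -/
def κ₂' : ℝ :=
  max (max (2 + 3 * S.ℓ ^ 2) (5 / S.ρ₂))
    (max ((16 * S.ℓ ^ 2 * (S.τ₁ + 1) ^ 2 / S.ρ₂) ^ (1 / 3 : ℝ)) (2 * √2 * S.ℓ / S.ρ₂))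

def φ₁ : ℝ := (1 / 2) * (S.ρ₂ * S.β - (3 * S.γ + 2 + 3 * S.ℓ ^ 2))

def φ₂ : ℝ :=
  3 * S.ρ ^ 2 * S.β ^ 2 - S.ρ₂ * S.β * S.γ + (S.ρ + 2) * S.γ ^ 2 + 1 + 5 / 2 * S.ℓ ^ 2

def φ₃ : ℝ := S.γ / 2 - 5 / 2 * S.ρ₂⁻¹

def φ₄ : ℝ := 2 * S.ρ * S.γ ^ 2 + 1 / 2 * S.ρ

def φ₅ : ℝ :=
  1 / 8 - (S.β + S.γ) ^ 2 / S.γ ^ 5 * S.ρ₂⁻¹ * S.ℓ ^ 2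
    - 1 / (2 * S.γ ^ 2) * (S.ρ₂⁻¹) ^ 2 * S.ℓ ^ 2

def φ₆ : ℝ :=
  (S.β + S.γ) / (2 * S.γ ^ 3) * S.ρ₂⁻¹ * S.ℓ ^ 2
    + 1 / (2 * S.γ ^ 2) * (S.ρ₂⁻¹) ^ 2 * S.ℓ ^ 2
    + (S.ρ₂⁻¹) ^ 2 / 2 * S.ℓ ^ 2 + S.ℓ ^ 2 / 2 + S.ℓ / 2

def φ₇ : ℝ := (S.ρ + 1) * S.γ + 1 / 2 * S.ρ * S.β

def φ₈ : ℝ :=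
  3 * S.ρ ^ 2 * S.β ^ 2 + (S.ρ - 2 * S.ρ₂) * S.β * S.γ + (S.ρ + 2) * S.γ ^ 2 + 1

def ε₁ : ℝ := (S.τ₁ * S.ρ₂ - 1) / (2 * S.τ₁ * S.ρ₂)

def ε₂ : ℝ :=
  max ((1 + S.τ₁ * S.ρ₂) / 2) ((1 + S.τ₁) / 2 + 1 / (2 * S.τ₁ * S.ρ₂ ^ 2))

def ε₃ (α : ℝ) : ℝ := min (S.φ₁ - α * S.φ₂) (S.φ₃ - α * S.φ₄)

def ε₅ : ℝ := S.ω * S.r * (S.δ - S.δ ^ 2 / 2)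

def ε₆ (α : ℝ) : ℝ := min (S.ν / 2) (S.ε₃ α) / S.ε₂

def ψ₂ (α : ℝ) : ℝ := S.φ₇ + α * S.φ₈

def ψ₃ : ℝ := 4 * (1 + S.ε₅⁻¹) * S.dHat ^ 2 * S.β ^ 2 * S.ρ ^ 2

def ψ₄ : ℝ :=
  4 * (1 + S.ε₅⁻¹) * S.dHat ^ 2
    * max (S.β ^ 2 * S.ρ ^ 2 + S.ℓ ^ 2) (S.γ ^ 2 * S.ρ) / S.ε₁

/-- Lower bound that `ψ₅` has to exceed, for the stepsize `α`. -/
def ψ₅Low (α : ℝ) : ℝ := (1 - 2 * S.ε₅) * S.ψ₂ α / S.ε₆ α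

def κHat₀ : ℝ := min (S.φ₁ / S.φ₂) (min (S.φ₃ / S.φ₄) (S.φ₅ / S.φ₆))

/-- The smallest positive root of `t * ε₃ t = 1`, and `+∞` if there is none. -/
def κ₅ : EReal := sInf {t : EReal | ∃ a : ℝ, 0 < a ∧ a * S.ε₃ a = 1 ∧ t = (a : EReal)}

def κ₆' (ψ₅ : ℝ) : ℝ :=
  √((S.ε₅ + 2 * S.ε₅ ^ 2) / ((1 - 2 * S.ε₅) * S.ψ₃ + S.ψ₄ * ψ₅))

/-- Upper bound for the stepsize. -/
def κ₀' (ψ₅ : ℝ) : EReal :=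
  min (S.κHat₀ : EReal) (min S.κ₅ ((S.κ₆' ψ₅ / (√(n : ℝ) * S.dTilde) : ℝ) : EReal))

/-- `α` lies in `(0, κ₀')` and `ψ₅` exceeds its lower bound. -/
def Admissible (α ψ₅ : ℝ) : Prop :=
  0 < α ∧ (α : EReal) < S.κ₀' ψ₅ ∧ S.ψ₅Low α < ψ₅

def κ₉ (α ψ₅ : ℝ) : ℝ :=
  √(1 - α * (S.ε₆ α - (1 - 2 * S.ε₅) * S.ψ₂ α * (1 / ψ₅)))

def κ₁₀ (α ψ₅ : ℝ) : ℝ :=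
  √(1 - (S.ε₅ + 2 * S.ε₅ ^ 2)
    + α ^ 2 * n * S.dTilde ^ 2 * ((1 - 2 * S.ε₅) * S.ψ₃ + S.ψ₄ * ψ₅))

/-- The averaging matrix `(1/n) 1 1ᵀ`. -/
def avgMat (n : ℕ) : Matrix (Fin n) (Fin n) ℝ := Matrix.of fun _ _ => 1 / (n : ℝ)

/-- `E = I - (1/n) 1 1ᵀ`. -/
def centerMat (n : ℕ) : Matrix (Fin n) (Fin n) ℝ := 1 - avgMat n

/-- With `L = [q Q] diag(0, Λ) [q Q]ᵀ` and `q = 1/√n`, this is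
`[q Q] diag(lam⁻¹, Λ⁻¹) [q Q]ᵀ = (L + lam q qᵀ)⁻¹`. -/
def dualMat (lam : ℝ) : Matrix (Fin n) (Fin n) ℝ := (S.L + lam • avgMat n)⁻¹

/-- `uᵀ (M ⊗ I_d) w` for stacked vectors `u`, `w`. -/
def stackedForm (M : Matrix (Fin n) (Fin n) ℝ) (u w : Fin n → Vec d) : ℝ :=
  ∑ i, ∑ j, M i j * inner ℝ (u i) (w j)

/-- The computable bound for the initial Lyapunov value; note `v_{i,0} = 0`. -/
def κν (lam : ℝ) (x₀ : Fin n → Vec d) : ℝ :=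
  let w : Fin n → Vec d := fun i => S.γ⁻¹ • gradient (S.f i) (avg x₀)
  1 / 2 * stackedForm (centerMat n) x₀ x₀
    + 1 / 2 * ((S.β + S.γ) / S.γ * stackedForm (S.dualMat lam) w w)
    + stackedForm (centerMat n * S.dualMat lam) x₀ w
    + 1 / (2 * S.ν) * (n * ‖gradient S.F (avg x₀)‖ ^ 2)

end Setting

end UnifiedCompression

end

/-! Let `e = x - x̂` be the error left after the compressed update of `x̂`. Since `y = L x̂` along
the whole run, the method is an exact primal-dual gradient iteration perturbed by `e`. Its integral
variable is replaced by `u = E F (v + ∇f(1 ⊗ x̄) / γ)`. On stacked vectors `E F` is the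
pseudo-inverse of `L`, so `u` does not depend on `λ`, and `γ L u` is the centred part of `γ v + ∇f(1
⊗ x̄)`.

The Lyapunov function is `V = ½‖Ex‖² + (β+γ)/(2γ) uᵀLu + ⟨Ex, u⟩ + n (f(x̄) - f*)`. In one step the
feedback `βL` produces a negative multiple of `‖Ex‖²`, the dual update one of `uᵀLu`, and the
Polyak–Łojasiewicz inequality one of `f(x̄) - f*`. The motion of `x̄` also shifts `u`; this costs a
multiple of the squared averaged gradient, which the descent lemma for `f` supplies. The outcome is
`lyapunov_step_le`: `V⁺ ≤ (1 - α ε₆) V + α ψ₂ ‖e‖²`.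

The compressor is controlled only on a ball, so convergence and the stay inside the ball are proved
together. The induction (`Invariant`) carries, at scale `s_k`, the bounds `V ≤ n d̃² ψ₅ C² s_k²` and
`‖x_{i,k} - x̂_{i,k-1}‖_p ≤ C s_k`. The second gives `‖e_i‖_p² ≤ (1 - 2ε₅) C² s_k²`
(`lpNorm_compress_sq_le`). Inserted in the Lyapunov inequality, this multiplies the bound on `V` by
at most `κ₉²`. The new distance to `x̂` is at most the error plus the length of the step, and that
length is controlled by `e` and `V` (`norm_nextX_sub_sq_le`); so the squared second bound is
multiplied by at most `κ₁₀²`. Any ratio above `κ₉` and `κ₁₀` therefore preserves both bounds, and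
`V` dominates the gap up to a constant (`le_lyapunov`).

Admissibility looks circular, because the range of `α` depends on `ψ₅` and the lower bound on `ψ₅`
depends on `α`. That lower bound is uniformly bounded for `α < κ̂₀ / 2`, so `ψ₅` can be fixed first
(`exists_admissible`). -/

namespace UnifiedCompression

/-! ### Comparison of `ℓ_p` norms -/

/-- The `ℓ_q` norm is at most the `ℓ_p` norm for `p ≤ q`. -/
lemma sum_rpow_rpow_inv_antitone {ι : Type*} (s : Finset ι) (a : ι → ℝ) (ha : ∀ i, 0 ≤ a i)
    {p q : ℝ} (hp : 0 < p) (hpq : p ≤ q) :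
    (∑ i ∈ s, a i ^ q) ^ (1 / q) ≤ (∑ i ∈ s, a i ^ p) ^ (1 / p) := by
  have hq : 0 < q := hp.trans_le hpq
  set T := ∑ i ∈ s, a i ^ p with hT
  have hT0 : 0 ≤ T := Finset.sum_nonneg fun i _ => Real.rpow_nonneg (ha i) _
  set N := T ^ (1 / p) with hN
  have hN0 : 0 ≤ N := Real.rpow_nonneg hT0 _
  have hNp : N ^ p = T := by
    rw [hN, ← Real.rpow_mul hT0, one_div_mul_cancel hp.ne', Real.rpow_one]
  have hle : ∀ i ∈ s, a i ≤ N := by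
    intro i hi
    rw [← Real.rpow_le_rpow_iff (ha i) hN0 hp, hNp]
    exact Finset.single_le_sum (f := fun i => a i ^ p)
      (fun j _ => Real.rpow_nonneg (ha j) _) hi
  have hsum : ∑ i ∈ s, a i ^ q ≤ N ^ q := by
    calc ∑ i ∈ s, a i ^ q = ∑ i ∈ s, a i ^ p * a i ^ (q - p) := by
          refine Finset.sum_congr rfl fun i _ => ?_
          rw [← Real.rpow_add_of_nonneg (ha i) hp.le (by linarith)]
          congr 1; ring
      _ ≤ ∑ i ∈ s, a i ^ p * N ^ (q - p) := by
          refine Finset.sum_le_sum fun i hi => ?_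
          exact mul_le_mul_of_nonneg_left
            (Real.rpow_le_rpow (ha i) (hle i hi) (by linarith)) (Real.rpow_nonneg (ha i) _)
      _ = N ^ q := by
          rw [← Finset.sum_mul, ← hT, ← hNp, ← Real.rpow_add_of_nonneg hN0 hp.le (by linarith)]
          congr 1; ring
  calc (∑ i ∈ s, a i ^ q) ^ (1 / q) ≤ (N ^ q) ^ (1 / q) :=
        Real.rpow_le_rpow (Finset.sum_nonneg fun i _ => Real.rpow_nonneg (ha i) _) hsum
          (by positivity)
    _ = N := by rw [← Real.rpow_mul hN0, mul_one_div_cancel hq.ne', Real.rpow_one]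

/-- The `ℓ_p` norm is at most `d ^ (1 / p - 1 / q)` times the `ℓ_q` norm for `p ≤ q`. -/
lemma sum_rpow_rpow_inv_le_card_mul {ι : Type*} (s : Finset ι) (a : ι → ℝ) (ha : ∀ i, 0 ≤ a i)
    {p q : ℝ} (hp : 0 < p) (hpq : p ≤ q) :
    (∑ i ∈ s, a i ^ p) ^ (1 / p) ≤
      (s.card : ℝ) ^ (1 / p - 1 / q) * (∑ i ∈ s, a i ^ q) ^ (1 / q) := by
  have hq : 0 < q := hp.trans_le hpq
  have hT0 : 0 ≤ ∑ i ∈ s, a i ^ p := Finset.sum_nonneg fun i _ => Real.rpow_nonneg (ha i) _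
  have hU0 : 0 ≤ ∑ i ∈ s, a i ^ q := Finset.sum_nonneg fun i _ => Real.rpow_nonneg (ha i) _
  -- Power mean inequality for the numbers `a i ^ p` with exponent `q / p ≥ 1`.
  have h := Real.rpow_sum_le_const_mul_sum_rpow_of_nonneg s (f := fun i => a i ^ p)
    (p := q / p) ((one_le_div hp).2 hpq) (fun i _ => Real.rpow_nonneg (ha i) _)
  have h1 : ∑ i ∈ s, (a i ^ p) ^ (q / p) = ∑ i ∈ s, a i ^ q := by
    refine Finset.sum_congr rfl fun i _ => ?_
    rw [← Real.rpow_mul (ha i), mul_div_cancel₀ _ hp.ne']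
  rw [h1] at h
  have h2 := Real.rpow_le_rpow (Real.rpow_nonneg hT0 _) h (by positivity : 0 ≤ 1 / q)
  rw [← Real.rpow_mul hT0, Real.mul_rpow (Real.rpow_nonneg (Nat.cast_nonneg _) _) hU0,
    ← Real.rpow_mul (Nat.cast_nonneg _)] at h2
  convert h2 using 3 <;> field_simp

lemma lpNorm_eq_sum {d : ℕ} {p : ℝ≥0∞} (hp : 0 < p.toReal) (x : Vec d) :
    lpNorm p x = (∑ i, |x i| ^ p.toReal) ^ (1 / p.toReal) := by
  simp only [lpNorm]
  rw [PiLp.norm_eq_sum hp]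
  simp

lemma norm_eq_sum_rpow {d : ℕ} (x : Vec d) :
    ‖x‖ = (∑ i, |x i| ^ (2 : ℝ)) ^ (1 / (2 : ℝ)) := by
  rw [PiLp.norm_eq_sum (by simp)]
  simp

lemma lpNorm_top {d : ℕ} (x : Vec d) : lpNorm ∞ x = ⨆ i, |x i| := by
  simp only [lpNorm]
  rw [PiLp.norm_eq_ciSup]
  simp

lemma lpNorm_add_le {d : ℕ} {p : ℝ≥0∞} (hp : 1 ≤ p) (x y : Vec d) :
    lpNorm p (x + y) ≤ lpNorm p x + lpNorm p y := by
  have : Fact (1 ≤ p) := ⟨hp⟩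
  exact norm_add_le (WithLp.toLp p (WithLp.ofLp x)) (WithLp.toLp p (WithLp.ofLp y))

lemma lpNorm_smul {d : ℕ} {p : ℝ≥0∞} (hp : 1 ≤ p) (c : ℝ) (x : Vec d) :
    lpNorm p (c • x) = |c| * lpNorm p x := by
  have : Fact (1 ≤ p) := ⟨hp⟩
  exact norm_smul c (WithLp.toLp p (WithLp.ofLp x))

lemma lpNorm_nonneg {d : ℕ} {p : ℝ≥0∞} (hp : 1 ≤ p) (x : Vec d) : 0 ≤ lpNorm p x := by
  have : Fact (1 ≤ p) := ⟨hp⟩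
  exact norm_nonneg (WithLp.toLp p (WithLp.ofLp x))

namespace Setting

variable {n d : ℕ} (S : Setting n d)

lemma lpNorm_le_dHat_mul (hp : 1 ≤ S.p) (x : Vec d) : lpNorm S.p x ≤ S.dHat * ‖x‖ := by
  unfold dHat
  split_ifs with h
  · have htop : S.p ≠ ∞ := (h.trans_lt (by simp)).ne
    have h1 : 0 < S.p.toReal := ENNReal.toReal_pos (by positivity) htop
    have h2 : S.p.toReal ≤ 2 := by
      simpa using ENNReal.toReal_mono (by simp) h
    rw [lpNorm_eq_sum h1, norm_eq_sum_rpow]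
    simpa using sum_rpow_rpow_inv_le_card_mul Finset.univ (fun i => |x i|)
      (fun i => abs_nonneg _) h1 h2
  · rw [one_mul]
    push Not at h
    by_cases htop : S.p = ∞
    · rw [htop, lpNorm_top]
      exact Real.iSup_le (fun i => PiLp.norm_apply_le x i) (norm_nonneg _)
    · have h2 : 2 ≤ S.p.toReal := by
        simpa using ENNReal.toReal_mono htop h.le
      rw [lpNorm_eq_sum (by linarith), norm_eq_sum_rpow]
      exact sum_rpow_rpow_inv_antitone Finset.univ (fun i => |x i|)
        (fun i => abs_nonneg _) two_pos h2

lemma norm_le_dTilde_mul (hp : 1 ≤ S.p) (x : Vec d) : ‖x‖ ≤ S.dTilde * lpNorm S.p x := by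
  unfold dTilde
  split_ifs with h
  · rw [one_mul]
    have htop : S.p ≠ ∞ := (h.trans_lt (by simp)).ne
    have h1 : 0 < S.p.toReal := ENNReal.toReal_pos (by positivity) htop
    have h2 : S.p.toReal ≤ 2 := by
      simpa using ENNReal.toReal_mono (by simp) h
    rw [lpNorm_eq_sum h1, norm_eq_sum_rpow]
    exact sum_rpow_rpow_inv_antitone Finset.univ (fun i => |x i|)
      (fun i => abs_nonneg _) h1 h2
  · push Not at h
    by_cases htop : S.p = ∞
    -- `∞.toReal = 0` and `1 / 0 = 0`, so the exponent of `d` in `dTilde` is `1 / 2` in this case.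
    · rw [htop, lpNorm_top, norm_eq_sum_rpow]
      have hB : ∀ i, |x i| ≤ ⨆ i, |x i| := le_ciSup (Set.finite_range _).bddAbove
      have hB0 : 0 ≤ ⨆ i, |x i| := Real.iSup_nonneg fun i => abs_nonneg _
      calc (∑ i, |x i| ^ (2 : ℝ)) ^ (1 / (2 : ℝ))
          ≤ (∑ _i : Fin d, (⨆ i, |x i|) ^ (2 : ℝ)) ^ (1 / (2 : ℝ)) := by
            refine Real.rpow_le_rpow (by positivity) ?_ (by positivity)
            exact Finset.sum_le_sum fun i _ => Real.rpow_le_rpow (abs_nonneg _) (hB i) two_pos.le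
        _ = _ := by
            rw [Finset.sum_const, nsmul_eq_mul, Real.mul_rpow (by positivity) (by positivity),
              ← Real.rpow_mul hB0]
            simp
    · have h2 : 2 ≤ S.p.toReal := by
        simpa using ENNReal.toReal_mono htop h.le
      rw [lpNorm_eq_sum (by linarith), norm_eq_sum_rpow]
      simpa using sum_rpow_rpow_inv_le_card_mul Finset.univ (fun i => |x i|)
        (fun i => abs_nonneg _) two_pos h2

lemma dHat_pos (hd : 1 ≤ d) : 0 < S.dHat := by
  have : (0 : ℝ) < d := by exact_mod_cast hd
  unfold dHat
  split_ifs <;> positivity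

lemma dTilde_pos (hd : 1 ≤ d) : 0 < S.dTilde := by
  have : (0 : ℝ) < d := by exact_mod_cast hd
  unfold dTilde
  split_ifs <;> positivity

end Setting

end UnifiedCompression

/-! ### Spectrum of the graph Laplacian and its pseudo-inverse. -/

namespace UnifiedCompression

open Matrix

/-- Coordinates of `M a` in an eigenbasis of the symmetric matrix `M`. -/
lemma inner_eigenvectorBasis_mulVec {n : ℕ} {M : Matrix (Fin n) (Fin n) ℝ} (hM : M.IsHermitian)
    (i : Fin n) (a : Fin n → ℝ) :
    inner ℝ (hM.eigenvectorBasis i) (WithLp.toLp 2 (M *ᵥ a)) =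
      hM.eigenvalues i * inner ℝ (hM.eigenvectorBasis i) (WithLp.toLp 2 a) := by
  have h1 : ∀ c : Fin n → ℝ, inner ℝ (hM.eigenvectorBasis i) (WithLp.toLp 2 c) =
      c ⬝ᵥ (hM.eigenvectorBasis i).ofLp := by
    intro c
    simp [EuclideanSpace.inner_eq_star_dotProduct]
  rw [h1, h1, dotProduct_comm, dotProduct_mulVec, ← mulVec_transpose,
    show Mᵀ = M from (conjTranspose_eq_transpose_of_trivial M).symm.trans hM,
    hM.mulVec_eigenvectorBasis, smul_dotProduct, dotProduct_comm, smul_eq_mul]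

lemma dotProduct_eq_sum_inner_eigenvectorBasis {n : ℕ} {M : Matrix (Fin n) (Fin n) ℝ}
    (hM : M.IsHermitian) (a b : Fin n → ℝ) :
    a ⬝ᵥ b = ∑ i, inner ℝ (hM.eigenvectorBasis i) (WithLp.toLp 2 a) *
      inner ℝ (hM.eigenvectorBasis i) (WithLp.toLp 2 b) := by
  have h := hM.eigenvectorBasis.sum_inner_mul_inner (WithLp.toLp 2 a) (WithLp.toLp 2 b)
  rw [EuclideanSpace.inner_toLp_toLp] at h
  rw [dotProduct_comm]
  simp only [star_trivial] at h
  rw [← h]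
  exact Finset.sum_congr rfl fun i _ => by rw [real_inner_comm]

namespace Setting

variable {n d : ℕ} (S : Setting n d)

lemma isHermitian_L (hg : S.UndirectedConnected) : S.L.IsHermitian := by
  have hA : S.Aᵀ = S.A := by ext i j; exact hg.symm j i
  simp [L, Matrix.IsHermitian, conjTranspose_eq_transpose_of_trivial, hA]

lemma L_mulVec_apply (a : Fin n → ℝ) (i : Fin n) :
    (S.L *ᵥ a) i = ∑ j, S.A i j * (a i - a j) := by
  simp only [L, sub_mulVec, Pi.sub_apply, mulVec_diagonal, mul_sub, Finset.sum_sub_distrib,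
    Finset.sum_mul]
  rfl

lemma L_mulVec_const (c : ℝ) : S.L *ᵥ (fun _ => c) = 0 := by
  ext i; simp [L_mulVec_apply]

lemma dotProduct_L_mulVec (hg : S.UndirectedConnected) (a : Fin n → ℝ) :
    a ⬝ᵥ (S.L *ᵥ a) = 1 / 2 * ∑ i, ∑ j, S.A i j * (a i - a j) ^ 2 := by
  have h1 : a ⬝ᵥ (S.L *ᵥ a) = ∑ i, ∑ j, S.A i j * (a i * (a i - a j)) := by
    simp only [dotProduct, L_mulVec_apply, Finset.mul_sum]
    exact Finset.sum_congr rfl fun i _ => Finset.sum_congr rfl fun j _ => by ring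
  have h2 : a ⬝ᵥ (S.L *ᵥ a) = ∑ i, ∑ j, S.A i j * (a j * (a j - a i)) := by
    rw [h1, Finset.sum_comm]
    exact Finset.sum_congr rfl fun i _ => Finset.sum_congr rfl fun j _ => by rw [hg.symm]
  have h3 : ∑ i, ∑ j, S.A i j * (a i - a j) ^ 2 =
      ∑ i, ∑ j, S.A i j * (a i * (a i - a j)) + ∑ i, ∑ j, S.A i j * (a j * (a j - a i)) := by
    simp only [← Finset.sum_add_distrib]
    exact Finset.sum_congr rfl fun i _ => Finset.sum_congr rfl fun j _ => by ring
  rw [h3, ← h1, ← h2]; ring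

lemma dotProduct_L_mulVec_nonneg (hg : S.UndirectedConnected) (a : Fin n → ℝ) :
    0 ≤ a ⬝ᵥ (S.L *ᵥ a) := by
  rw [S.dotProduct_L_mulVec hg]
  have := hg.nonneg
  exact mul_nonneg (by norm_num) (Finset.sum_nonneg fun i _ => Finset.sum_nonneg fun j _ =>
    mul_nonneg (this i j) (sq_nonneg _))

/-- On a connected graph the kernel of the Laplacian consists of the constant vectors. -/
lemma eq_of_dotProduct_L_mulVec_eq_zero (hg : S.UndirectedConnected) {a : Fin n → ℝ}
    (ha : a ⬝ᵥ (S.L *ᵥ a) = 0) (i j : Fin n) : a i = a j := by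
  rw [S.dotProduct_L_mulVec hg] at ha
  have hnn : ∀ i j, 0 ≤ S.A i j * (a i - a j) ^ 2 := fun i j =>
    mul_nonneg (hg.nonneg i j) (sq_nonneg _)
  have h0 : ∀ i j, S.A i j * (a i - a j) ^ 2 = 0 := by
    have h1 : ∑ i, ∑ j, S.A i j * (a i - a j) ^ 2 = 0 := by linarith
    intro i j
    have h2 := (Finset.sum_eq_zero_iff_of_nonneg
      (fun i _ => Finset.sum_nonneg fun j _ => hnn i j)).1 h1 i (Finset.mem_univ i)
    exact (Finset.sum_eq_zero_iff_of_nonneg (fun j _ => hnn i j)).1 h2 j (Finset.mem_univ j)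
  have hpos : ∀ i j, 0 < S.A i j → a i = a j := by
    intro i j hij
    rcases mul_eq_zero.1 (h0 i j) with h | h
    · exact absurd h hij.ne'
    · exact sub_eq_zero.1 (pow_eq_zero_iff (two_ne_zero)|>.1 h)
  obtain ⟨p⟩ := hg.connected.preconnected i j
  induction p with
  | nil => rfl
  | cons h _ ih =>
    refine Eq.trans ?_ ih
    rw [SimpleGraph.fromRel_adj] at h
    rcases h.2 with h | h
    · exact hpos _ _ h
    · exact (hpos _ _ h).symm

lemma eigenvalues_L_nonneg (hg : S.UndirectedConnected) (i : Fin n) :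
    0 ≤ (S.isHermitian_L hg).eigenvalues i := by
  have h := S.dotProduct_L_mulVec_nonneg hg ((S.isHermitian_L hg).eigenvectorBasis i).ofLp
  have h1 : ((S.isHermitian_L hg).eigenvectorBasis i).ofLp ⬝ᵥ
      ((S.isHermitian_L hg).eigenvectorBasis i).ofLp = 1 := by
    have := (S.isHermitian_L hg).eigenvectorBasis.inner_eq_one i
    rwa [EuclideanSpace.inner_eq_star_dotProduct, star_trivial] at this
  rwa [(S.isHermitian_L hg).mulVec_eigenvectorBasis, dotProduct_smul, h1, smul_eq_mul,
    mul_one] at h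

lemma eigenvalues_L_le_ρ (hg : S.UndirectedConnected) (i : Fin n) :
    (S.isHermitian_L hg).eigenvalues i ≤ S.ρ := by
  have hmem := (S.isHermitian_L hg).eigenvalues_mem_spectrum_real i
  have hfin : (spectrum ℝ S.L).Finite := S.L.finite_real_spectrum
  have hne : spectralRadius ℝ S.L ≠ ∞ := by
    obtain ⟨B, hB⟩ := (hfin.image fun k => ‖k‖₊).bddAbove
    refine ne_top_of_le_ne_top (ENNReal.coe_ne_top (r := B)) ?_
    exact iSup₂_le fun k hk => ENNReal.coe_le_coe.2 (hB (Set.mem_image_of_mem _ hk))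
  have hle : ((‖(S.isHermitian_L hg).eigenvalues i‖₊ : NNReal) : ℝ≥0∞) ≤ spectralRadius ℝ S.L :=
    le_iSup₂ (f := fun k (_ : k ∈ spectrum ℝ S.L) => ((‖k‖₊ : NNReal) : ℝ≥0∞)) _ hmem
  have h := ENNReal.toReal_mono hne hle
  rw [ENNReal.coe_toReal, coe_nnnorm] at h
  exact (le_abs_self _).trans h

/-- Otherwise `L = 0`, and connectivity would force every vector to be constant, which fails for a
unit vector when `n ≥ 2`. This makes the set defining `ρ₂` nonempty. -/
lemma exists_eigenvalue_L_pos (hn : 2 ≤ n) (hg : S.UndirectedConnected) :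
    ∃ i, 0 < (S.isHermitian_L hg).eigenvalues i := by
  by_contra! hcon
  have h0 : (S.isHermitian_L hg).eigenvalues = 0 := by
    ext i; exact le_antisymm (hcon i) (S.eigenvalues_L_nonneg hg i)
  have hL : S.L = 0 := (S.isHermitian_L hg).eigenvalues_eq_zero_iff.1 h0
  have := S.eq_of_dotProduct_L_mulVec_eq_zero hg (a := Pi.single ⟨0, by omega⟩ 1)
    (by simp [hL]) ⟨0, by omega⟩ ⟨1, by omega⟩
  simp at this

lemma ρ₂_mem (hn : 2 ≤ n) (hg : S.UndirectedConnected) :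
    S.ρ₂ ∈ {μ : ℝ | μ ∈ spectrum ℝ S.L ∧ 0 < μ} := by
  obtain ⟨i, hi⟩ := S.exists_eigenvalue_L_pos hn hg
  exact Set.Nonempty.csInf_mem
    ⟨_, (S.isHermitian_L hg).eigenvalues_mem_spectrum_real i, hi⟩
    (S.L.finite_real_spectrum.subset fun _ h => h.1)

lemma ρ₂_pos (hn : 2 ≤ n) (hg : S.UndirectedConnected) : 0 < S.ρ₂ := (S.ρ₂_mem hn hg).2

lemma ρ₂_le_eigenvalues_L (hg : S.UndirectedConnected) {i : Fin n}
    (hi : 0 < (S.isHermitian_L hg).eigenvalues i) :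
    S.ρ₂ ≤ (S.isHermitian_L hg).eigenvalues i :=
  csInf_le ⟨0, fun _ h => h.2.le⟩ ⟨(S.isHermitian_L hg).eigenvalues_mem_spectrum_real i, hi⟩

lemma ρ₂_le_ρ (hn : 2 ≤ n) (hg : S.UndirectedConnected) : S.ρ₂ ≤ S.ρ := by
  obtain ⟨i, hi⟩ := S.exists_eigenvalue_L_pos hn hg
  exact (S.ρ₂_le_eigenvalues_L hg hi).trans (S.eigenvalues_L_le_ρ hg i)

/-- In each eigendirection this is `μ² ≤ ρ μ` for `0 ≤ μ ≤ ρ`. -/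
lemma L_mulVec_sq_le (hg : S.UndirectedConnected) (a : Fin n → ℝ) :
    (S.L *ᵥ a) ⬝ᵥ (S.L *ᵥ a) ≤ S.ρ * (a ⬝ᵥ (S.L *ᵥ a)) := by
  rw [dotProduct_eq_sum_inner_eigenvectorBasis (S.isHermitian_L hg),
    dotProduct_eq_sum_inner_eigenvectorBasis (S.isHermitian_L hg), Finset.mul_sum]
  refine Finset.sum_le_sum fun i _ => ?_
  rw [inner_eigenvectorBasis_mulVec]
  nlinarith [mul_nonneg (mul_nonneg (S.eigenvalues_L_nonneg hg i)
    (sub_nonneg.2 (S.eigenvalues_L_le_ρ hg i)))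
    (sq_nonneg (inner ℝ ((S.isHermitian_L hg).eigenvectorBasis i) (WithLp.toLp 2 a)))]

/-- Eigenvectors for the eigenvalue `0` are constant by connectivity, hence orthogonal to `a`; every
other eigenvalue is at least `ρ₂`. -/
lemma ρ₂_mul_le (hg : S.UndirectedConnected) (a : Fin n → ℝ)
    (ha : ∑ i, a i = 0) : S.ρ₂ * (a ⬝ᵥ a) ≤ a ⬝ᵥ (S.L *ᵥ a) := by
  rw [dotProduct_eq_sum_inner_eigenvectorBasis (S.isHermitian_L hg) a (S.L *ᵥ a),
    dotProduct_eq_sum_inner_eigenvectorBasis (S.isHermitian_L hg), Finset.mul_sum]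
  refine Finset.sum_le_sum fun i _ => ?_
  rw [inner_eigenvectorBasis_mulVec]
  rcases (S.eigenvalues_L_nonneg hg i).eq_or_lt with h | h
  · have h0 : inner ℝ ((S.isHermitian_L hg).eigenvectorBasis i) (WithLp.toLp 2 a) = 0 := by
      have hc := S.eq_of_dotProduct_L_mulVec_eq_zero hg
        (a := ((S.isHermitian_L hg).eigenvectorBasis i).ofLp)
        (by rw [(S.isHermitian_L hg).mulVec_eigenvectorBasis, ← h]; simp)
      simp only [EuclideanSpace.inner_eq_star_dotProduct, star_trivial, dotProduct]
      rw [Finset.sum_congr rfl fun j _ => by rw [hc j i], ← Finset.sum_mul]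
      simp [ha]
    simp [h0]
  · nlinarith [mul_nonneg (sub_nonneg.2 (S.ρ₂_le_eigenvalues_L hg h))
      (sq_nonneg (inner ℝ ((S.isHermitian_L hg).eigenvectorBasis i) (WithLp.toLp 2 a)))]

/-! ### The matrix `(L + lam J)⁻¹` -/

lemma L_mul_avgMat : S.L * avgMat n = 0 := by
  ext i j
  have := congrFun (S.L_mulVec_const (1 / (n : ℝ))) i
  simpa [Matrix.mul_apply, avgMat, mulVec, dotProduct] using this

lemma avgMat_transpose : (avgMat n)ᵀ = avgMat n := rfl

lemma L_transpose (hg : S.UndirectedConnected) : S.Lᵀ = S.L := by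
  simpa [Matrix.IsHermitian, conjTranspose_eq_transpose_of_trivial] using S.isHermitian_L hg

lemma avgMat_mul_L (hg : S.UndirectedConnected) : avgMat n * S.L = 0 := by
  have := congrArg transpose S.L_mul_avgMat
  rwa [transpose_mul, avgMat_transpose, S.L_transpose hg, transpose_zero] at this

lemma avgMat_mul_avgMat (hn : n ≠ 0) : avgMat n * avgMat n = avgMat n := by
  ext i j
  have : (n : ℝ) ≠ 0 := by exact_mod_cast hn
  simp only [Matrix.mul_apply, avgMat, of_apply, Finset.sum_const, Finset.card_univ,
    Fintype.card_fin, nsmul_eq_mul]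
  field_simp

lemma centerMat_mul_centerMat (hn : n ≠ 0) : centerMat n * centerMat n = centerMat n := by
  simp only [centerMat, sub_mul, mul_sub, one_mul, mul_one, avgMat_mul_avgMat hn]
  abel

lemma centerMat_transpose : (centerMat n)ᵀ = centerMat n := by
  simp [centerMat, avgMat_transpose]

lemma avgMat_mulVec (a : Fin n → ℝ) : avgMat n *ᵥ a = fun _ => 1 / (n : ℝ) * ∑ i, a i := by
  ext i
  simp [avgMat, mulVec, dotProduct, Finset.mul_sum]

/-- As `J L = 0` and `J² = J`, applying `J` to `(L + λJ) a = 0` gives `J a = 0`, then `L a = 0`. So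
`a` is constant with zero mean. -/
lemma isUnit_det_L_add (hn : 2 ≤ n) (hg : S.UndirectedConnected) {lam : ℝ} (hlam : 0 < lam) :
    IsUnit (S.L + lam • avgMat n).det := by
  rw [← Matrix.isUnit_iff_isUnit_det, ← Matrix.mulVec_injective_iff_isUnit]
  have hn0 : (n : ℝ) ≠ 0 := by positivity
  refine (injective_iff_map_eq_zero (S.L + lam • avgMat n).mulVecLin).2 fun a ha => ?_
  rw [mulVecLin_apply, add_mulVec, smul_mulVec] at ha
  have hJ : avgMat n *ᵥ a = 0 := by
    have h := congrArg (fun b => avgMat n *ᵥ b) ha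
    simp only [mulVec_add, mulVec_mulVec, mulVec_smul, S.avgMat_mul_L hg, zero_mulVec, zero_add,
      avgMat_mul_avgMat (by omega : n ≠ 0), mulVec_zero] at h
    exact (smul_eq_zero.1 h).resolve_left hlam.ne'
  rw [hJ, smul_zero, add_zero] at ha
  have hc := S.eq_of_dotProduct_L_mulVec_eq_zero hg (a := a) (by rw [ha, dotProduct_zero])
  ext i
  have h1 := congrFun hJ i
  rw [avgMat_mulVec] at h1
  simp only [Finset.sum_congr rfl fun j _ => hc j i, Finset.sum_const, Finset.card_univ,
    Fintype.card_fin, nsmul_eq_mul, Pi.zero_apply] at h1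
  field_simp at h1
  exact h1

lemma dualMat_transpose (hg : S.UndirectedConnected) (lam : ℝ) :
    (S.dualMat lam)ᵀ = S.dualMat lam := by
  simp [dualMat, transpose_nonsing_inv, S.L_transpose hg, avgMat_transpose]

lemma smul_avgMat_mul_dualMat (hn : 2 ≤ n) (hg : S.UndirectedConnected) {lam : ℝ}
    (hlam : 0 < lam) : lam • (avgMat n * S.dualMat lam) = avgMat n := by
  have h := congrArg (fun M => avgMat n * M)
    (Matrix.mul_nonsing_inv _ (S.isUnit_det_L_add hn hg hlam))
  simpa [← mul_assoc, mul_add, S.avgMat_mul_L hg, avgMat_mul_avgMat (by omega : n ≠ 0),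
    dualMat] using h

/-- From `(L + λJ) F = I` and `λ J F = J` there remains `L F = I - J`: `F` inverts `L` on centred
vectors, whatever `λ > 0` is. -/
lemma L_mul_dualMat (hn : 2 ≤ n) (hg : S.UndirectedConnected) {lam : ℝ}
    (hlam : 0 < lam) : S.L * S.dualMat lam = centerMat n := by
  have h := Matrix.mul_nonsing_inv _ (S.isUnit_det_L_add hn hg hlam)
  rw [add_mul, smul_mul_assoc] at h
  have h2 := S.smul_avgMat_mul_dualMat hn hg hlam
  rw [dualMat] at h2
  rw [h2] at h
  exact eq_sub_of_add_eq h

lemma dualMat_mul_L (hn : 2 ≤ n) (hg : S.UndirectedConnected) {lam : ℝ}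
    (hlam : 0 < lam) : S.dualMat lam * S.L = centerMat n := by
  have := congrArg transpose (S.L_mul_dualMat hn hg hlam)
  rwa [transpose_mul, S.dualMat_transpose hg, S.L_transpose hg, centerMat_transpose] at this

lemma L_mul_centerMat : S.L * centerMat n = S.L := by
  simp [centerMat, mul_sub, S.L_mul_avgMat]

lemma centerMat_mul_L (hg : S.UndirectedConnected) : centerMat n * S.L = S.L := by
  simp [centerMat, sub_mul, S.avgMat_mul_L hg]

end Setting

end UnifiedCompression

/-! ### Stacked vectors and the operators `M ⊗ I_d`. -/

noncomputable section

namespace UnifiedCompression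

open Matrix

/-- Stacked vectors `col(x_1, …, x_n)` with the Euclidean inner product of `ℝ^{nd}`. -/
abbrev Stack (n d : ℕ) : Type := PiLp 2 (fun _ : Fin n => Vec d)

/-- The stacked vector with blocks `x i`. -/
abbrev stack {n d : ℕ} (x : Fin n → Vec d) : Stack n d := WithLp.toLp 2 x

/-- The operator `M ⊗ I_d` on stacked vectors. -/
def kron {n : ℕ} (d : ℕ) (M : Matrix (Fin n) (Fin n) ℝ) : Stack n d →ₗ[ℝ] Stack n d where
  toFun x := stack fun i => ∑ j, M i j • x j
  map_add' x y := by
    ext i a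
    simp [Finset.sum_add_distrib]
  map_smul' c x := by
    ext i a
    simp only [PiLp.smul_apply, WithLp.ofLp_sum, WithLp.ofLp_smul, Finset.sum_apply, Pi.smul_apply,
      smul_eq_mul, RingHom.id_apply, Finset.mul_sum]
    exact Finset.sum_congr rfl fun j _ => by ring

variable {n d : ℕ}

lemma kron_apply (M : Matrix (Fin n) (Fin n) ℝ) (x : Stack n d) (i : Fin n) :
    kron d M x i = ∑ j, M i j • x j := rfl

lemma kron_mul (M N : Matrix (Fin n) (Fin n) ℝ) (x : Stack n d) :
    kron d (M * N) x = kron d M (kron d N x) := by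
  ext i a
  simp only [kron_apply, Matrix.mul_apply, WithLp.ofLp_sum, WithLp.ofLp_smul, Finset.sum_apply,
    Pi.smul_apply, smul_eq_mul, Finset.mul_sum, Finset.sum_mul]
  rw [Finset.sum_comm]
  exact Finset.sum_congr rfl fun j _ => Finset.sum_congr rfl fun k _ => by ring

lemma kron_one (x : Stack n d) : kron d 1 x = x := by
  ext i a
  simp [kron_apply, Matrix.one_apply]

lemma kron_sub (M N : Matrix (Fin n) (Fin n) ℝ) (x : Stack n d) :
    kron d (M - N) x = kron d M x - kron d N x := by
  ext i a
  simp [kron_apply, sub_mul, Finset.sum_sub_distrib]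

lemma kron_zero (x : Stack n d) : kron d 0 x = 0 := by
  ext i a
  simp [kron_apply]

lemma inner_kron (M : Matrix (Fin n) (Fin n) ℝ) (x y : Stack n d) :
    inner ℝ x (kron d M y) = Setting.stackedForm M x y := by
  simp only [PiLp.inner_apply (𝕜 := ℝ) (x := x), kron_apply, inner_sum, real_inner_smul_right,
    Setting.stackedForm]

lemma inner_kron_right (M : Matrix (Fin n) (Fin n) ℝ) (x y : Stack n d) :
    inner ℝ x (kron d M y) = inner ℝ (kron d Mᵀ x) y := by
  rw [real_inner_comm _ (kron d Mᵀ x), inner_kron, inner_kron]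
  simp only [Setting.stackedForm, transpose_apply]
  rw [Finset.sum_comm]
  exact Finset.sum_congr rfl fun j _ => Finset.sum_congr rfl fun k _ => by rw [real_inner_comm]

/-- The `a`-th coordinate of every block. -/
def coord (a : Fin d) (x : Stack n d) : Fin n → ℝ := fun i => x i a

/-- Reduces a form of `M ⊗ I_d` to `d` forms of `M`, one per coordinate, so the spectral bounds on
`ℝ^n` carry over to stacks. -/
lemma inner_eq_sum_coord (x y : Stack n d) :
    inner ℝ x y = ∑ a, coord a x ⬝ᵥ coord a y := by
  simp only [PiLp.inner_apply, coord, dotProduct]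
  rw [Finset.sum_comm]
  exact Finset.sum_congr rfl fun j _ => Finset.sum_congr rfl fun k _ => by
    simp [mul_comm]

lemma coord_kron (M : Matrix (Fin n) (Fin n) ℝ) (a : Fin d) (x : Stack n d) :
    coord a (kron d M x) = M *ᵥ coord a x := by
  ext i
  simp [coord, kron_apply, mulVec, dotProduct]

namespace Setting

variable (S : Setting n d)

lemma avg_eq_sum (x : Fin n → Vec d) : avg x = ∑ j, (1 / (n : ℝ)) • x j := by
  rw [avg, Finset.smul_sum]

lemma kron_avgMat_apply (x : Stack n d) (i : Fin n) : kron d (avgMat n) x i = avg x := by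
  rw [kron_apply, avg_eq_sum]; rfl

lemma kron_centerMat_apply (x : Stack n d) (i : Fin n) :
    kron d (centerMat n) x i = x i - avg x := by
  rw [centerMat, kron_sub, kron_one, PiLp.sub_apply, kron_avgMat_apply]

lemma kron_centerMat_idem (hn : n ≠ 0) (x : Stack n d) :
    kron d (centerMat n) (kron d (centerMat n) x) = kron d (centerMat n) x := by
  rw [← kron_mul, centerMat_mul_centerMat hn]

lemma inner_kron_L_symm (hg : S.UndirectedConnected) (x y : Stack n d) :
    inner ℝ x (kron d S.L y) = inner ℝ (kron d S.L x) y := by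
  rw [inner_kron_right, S.L_transpose hg]

lemma inner_kron_centerMat (x y : Stack n d) :
    inner ℝ x (kron d (centerMat n) y) = inner ℝ (kron d (centerMat n) x) y := by
  rw [inner_kron_right, centerMat_transpose]

lemma norm_kron_L_sq_le (hg : S.UndirectedConnected) (x : Stack n d) :
    ‖kron d S.L x‖ ^ 2 ≤ S.ρ * inner ℝ x (kron d S.L x) := by
  rw [← real_inner_self_eq_norm_sq, inner_eq_sum_coord, inner_eq_sum_coord, Finset.mul_sum]
  refine Finset.sum_le_sum fun a _ => ?_
  rw [coord_kron]
  exact S.L_mulVec_sq_le hg _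

lemma inner_kron_L_nonneg (hg : S.UndirectedConnected) (x : Stack n d) :
    0 ≤ inner ℝ x (kron d S.L x) := by
  rw [inner_eq_sum_coord]
  refine Finset.sum_nonneg fun a _ => ?_
  rw [coord_kron]
  exact S.dotProduct_L_mulVec_nonneg hg _

lemma ρ₂_mul_norm_sq_le (hn : 2 ≤ n) (hg : S.UndirectedConnected) {x : Stack n d}
    (hx : kron d (centerMat n) x = x) :
    S.ρ₂ * ‖x‖ ^ 2 ≤ inner ℝ x (kron d S.L x) := by
  rw [← real_inner_self_eq_norm_sq, inner_eq_sum_coord, inner_eq_sum_coord, Finset.mul_sum]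
  refine Finset.sum_le_sum fun a _ => ?_
  rw [coord_kron]
  refine S.ρ₂_mul_le hg _ ?_
  have hn0 : (n : ℝ) ≠ 0 := by positivity
  have h0 : kron d (avgMat n) x = 0 := by
    have h := hx
    rw [centerMat, kron_sub, kron_one] at h
    exact sub_eq_self.1 h
  have h1 := congrArg (coord a) h0
  rw [coord_kron, avgMat_mulVec] at h1
  have h2 := congrFun h1 ⟨0, by omega⟩
  have h3 : coord a (0 : Stack n d) ⟨0, by omega⟩ = 0 := rfl
  rw [h3] at h2
  exact (mul_eq_zero.1 h2).resolve_left (by positivity)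

lemma kron_L_kron_center_dual (hn : 2 ≤ n) (hg : S.UndirectedConnected) {lam : ℝ}
    (hlam : 0 < lam) (x : Stack n d) :
    kron d S.L (kron d (centerMat n * S.dualMat lam) x) = kron d (centerMat n) x := by
  rw [← kron_mul, ← mul_assoc, S.L_mul_centerMat, S.L_mul_dualMat hn hg hlam]

lemma kron_center_dual_kron_L (hn : 2 ≤ n) (hg : S.UndirectedConnected) {lam : ℝ}
    (hlam : 0 < lam) (x : Stack n d) :
    kron d (centerMat n * S.dualMat lam) (kron d S.L x) = kron d (centerMat n) x := by
  rw [← kron_mul, mul_assoc, S.dualMat_mul_L hn hg hlam, centerMat_mul_centerMat (by omega)]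

lemma kron_center_kron_center_dual (hn : 2 ≤ n) (lam : ℝ) (x : Stack n d) :
    kron d (centerMat n) (kron d (centerMat n * S.dualMat lam) x) =
      kron d (centerMat n * S.dualMat lam) x := by
  rw [← kron_mul, ← mul_assoc, centerMat_mul_centerMat (by omega)]

/-- Restricting the dual form to centered vectors only decreases it. -/
lemma inner_kron_center_dual_le (hn : 2 ≤ n) (hg : S.UndirectedConnected) {lam : ℝ}
    (hlam : 0 < lam) (w : Stack n d) :
    inner ℝ (kron d (centerMat n * S.dualMat lam) w)
      (kron d S.L (kron d (centerMat n * S.dualMat lam) w)) ≤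
      stackedForm (S.dualMat lam) w w := by
  set F := S.dualMat lam
  have h1 : inner ℝ (kron d (centerMat n * F) w) (kron d S.L (kron d (centerMat n * F) w)) =
      inner ℝ w (kron d (centerMat n * F) w) := by
    rw [S.kron_L_kron_center_dual hn hg hlam, inner_kron_centerMat,
      S.kron_center_kron_center_dual hn, real_inner_comm]
  have h2 : kron d F w = kron d (centerMat n * F) w + kron d (avgMat n * F) w := by
    rw [centerMat, sub_mul, one_mul, kron_sub]; abel
  -- The dropped part lives on the averages and equals `λ⁻¹ ‖J w‖²`.
  have h3 : 0 ≤ inner ℝ w (kron d (avgMat n * F) w) := by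
    have h4 : kron d (avgMat n) w = lam • kron d (avgMat n * F) w := by
      conv_lhs => rw [← S.smul_avgMat_mul_dualMat hn hg hlam]
      ext i a
      simp [kron_apply, Finset.mul_sum, mul_assoc, F]
    have h5 : kron d (avgMat n * F) w = lam⁻¹ • kron d (avgMat n) w := by
      rw [h4, smul_smul, inv_mul_cancel₀ hlam.ne', one_smul]
    rw [h5, real_inner_smul_right]
    refine mul_nonneg (by positivity) ?_
    rw [← avgMat_mul_avgMat (by omega : n ≠ 0), kron_mul, inner_kron_right, avgMat_transpose]
    exact real_inner_self_nonneg
  rw [h1, ← inner_kron, h2, inner_add_right]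
  linarith

end Setting

end UnifiedCompression

end

/-! ### One-step estimate of the quadratic Lyapunov part in an abstract inner product space. -/

noncomputable section

namespace UnifiedCompression

variable {H : Type*} [NormedAddCommGroup H] [InnerProductSpace ℝ H]

lemma abs_inner_le_add_sq (a b : H) {c : ℝ} (hc : 0 < c) :
    |inner ℝ a b| ≤ c * ‖a‖ ^ 2 + 1 / (4 * c) * ‖b‖ ^ 2 := by
  refine (abs_real_inner_le_norm a b).trans ?_
  have h : 0 ≤ 1 / (4 * c) * (2 * c * ‖a‖ - ‖b‖) ^ 2 := by positivity
  have h2 : 1 / (4 * c) * (2 * c * ‖a‖ - ‖b‖) ^ 2 =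
      c * ‖a‖ ^ 2 + 1 / (4 * c) * ‖b‖ ^ 2 - ‖a‖ * ‖b‖ := by
    field_simp; ring
  linarith

/-- The part of the Lyapunov function that is quadratic in the consensus error `x` and the
dual variable `u`. -/
def quadLyapunov (β γ : ℝ) (L : H →ₗ[ℝ] H) (x u : H) : ℝ :=
  1 / 2 * ‖x‖ ^ 2 + (β + γ) / (2 * γ) * inner ℝ u (L u) + inner ℝ x u

/-- Here `z` stands for the centred compressed point, `h` for the gradient deviation and `r` for the
dual drift. The weight `(β + γ) / (2γ)` makes the first-order terms `β ⟨Lu, z⟩` cancel. The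
remaining coupling of `u` with `x` and `z` is `-γ ⟨Lu, x - z⟩`, which sees only the compression
error. -/
lemma quadLyapunov_step_eq {β γ α : ℝ} (hγ : γ ≠ 0) {L : H →ₗ[ℝ] H}
    (hL : ∀ a b, inner ℝ a (L b) = inner ℝ (L a) b) (x z u h r : H) :
    quadLyapunov β γ L (x - α • (β • L z + γ • L u + h)) (u + (α * γ) • z + γ⁻¹ • r) =
      quadLyapunov β γ L x u
      + α * (- β * inner ℝ x (L z) + γ * inner ℝ x z - γ * inner ℝ (L u) (x - z)
          - γ * inner ℝ u (L u) - inner ℝ x h - inner ℝ h u)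
      + α ^ 2 * (1 / 2 * ‖β • L z + (γ • L u + h)‖ ^ 2 - γ * inner ℝ (γ • L u + h) z
          + (γ ^ 2 - β * γ) / 2 * inner ℝ z (L z))
      + (γ⁻¹ * inner ℝ x r + (β + γ) / γ ^ 2 * inner ℝ (L u) r + α * inner ℝ z (L r)
          - α * inner ℝ (L u) r - α / γ * inner ℝ h r
          + (β + γ) / (2 * γ ^ 3) * inner ℝ r (L r)) := by
  simp only [quadLyapunov, ← real_inner_self_eq_norm_sq, map_add, map_smul, inner_add_left,
    inner_add_right, inner_sub_left, inner_sub_right, real_inner_smul_left,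
    real_inner_smul_right]
  have hc : ∀ a b, inner ℝ (L a) b = inner ℝ b (L a) := fun a b => real_inner_comm _ _
  have hs : ∀ a b, inner ℝ a (L b) = inner ℝ b (L a) := fun a b => by rw [hL, real_inner_comm]
  simp only [hc z x, hc z z, hc z u, hc z h, hc z r, hc u x, hc u z, hc u u, hc u h, hc u r,
    hs u z, hs r u, hs r z, real_inner_comm (L u) (L z),
    real_inner_comm x h, real_inner_comm u h]
  field_simp
  ring

/-- This and the next two lemmas replace spectral calculus: Young's inequality for `⟨a, La⟩`, with
the weight tuned so that half of the form is absorbed, converts one bound on `L` into another. -/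
lemma inner_le_of_norm_sq_le {L : H →ₗ[ℝ] H} {ρ : ℝ}
    (hρ : ∀ a, ‖L a‖ ^ 2 ≤ ρ * inner ℝ a (L a)) (hρ0 : 0 < ρ) (a : H) :
    inner ℝ a (L a) ≤ ρ * ‖a‖ ^ 2 := by
  have h1 := (abs_le.1 (abs_inner_le_add_sq a (L a) (c := ρ / 2) (by positivity))).2
  have h2 := hρ a
  have h3 : 1 / (4 * (ρ / 2)) * ‖L a‖ ^ 2 ≤ 1 / 2 * inner ℝ a (L a) := by
    calc _ ≤ 1 / (4 * (ρ / 2)) * (ρ * inner ℝ a (L a)) := by gcongr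
      _ = _ := by field_simp; norm_num
  linarith

lemma inner_le_inv_mul_norm_sq {L : H →ₗ[ℝ] H} {ρ₂ : ℝ} (hρ₂ : 0 < ρ₂) {a : H}
    (ha : ρ₂ * ‖a‖ ^ 2 ≤ inner ℝ a (L a)) : inner ℝ a (L a) ≤ ρ₂⁻¹ * ‖L a‖ ^ 2 := by
  have h1 := (abs_le.1 (abs_inner_le_add_sq a (L a) (c := ρ₂ / 2) (by positivity))).2
  have h3 : 1 / (4 * (ρ₂ / 2)) * ‖L a‖ ^ 2 = 1 / 2 * (ρ₂⁻¹ * ‖L a‖ ^ 2) := by field_simp; norm_num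
  rw [h3] at h1
  linarith

lemma norm_sq_le_inv_sq_mul {L : H →ₗ[ℝ] H} {ρ₂ : ℝ} (hρ₂ : 0 < ρ₂) {a : H}
    (ha : ρ₂ * ‖a‖ ^ 2 ≤ inner ℝ a (L a)) : ‖a‖ ^ 2 ≤ (ρ₂⁻¹) ^ 2 * ‖L a‖ ^ 2 := by
  have h1 := inner_le_inv_mul_norm_sq hρ₂ ha
  have h2 : ‖a‖ ^ 2 ≤ ρ₂⁻¹ * (ρ₂⁻¹ * ‖L a‖ ^ 2) := by
    rw [← div_eq_inv_mul, le_div_iff₀ hρ₂]; linarith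
  linarith [h2, (by ring : ρ₂⁻¹ * (ρ₂⁻¹ * ‖L a‖ ^ 2) = (ρ₂⁻¹) ^ 2 * ‖L a‖ ^ 2)]

/-- Cauchy–Schwarz with weights for the form of a positive semidefinite operator. -/
lemma inner_map_le_of_psd {L : H →ₗ[ℝ] H} (hL : ∀ a b, inner ℝ a (L b) = inner ℝ (L a) b)
    (hpsd : ∀ a, 0 ≤ inner ℝ a (L a)) (a b : H) {c : ℝ} (hc : 0 < c) :
    inner ℝ (L a) b ≤ c * inner ℝ a (L a) + 1 / (4 * c) * inner ℝ b (L b) := by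
  have h := hpsd ((2 * c) • a - b)
  simp only [map_sub, map_smul, inner_sub_left, inner_sub_right, real_inner_smul_left,
    real_inner_smul_right] at h
  have e1 : inner ℝ b (L a) = inner ℝ (L a) b := real_inner_comm _ _
  have e2 : inner ℝ a (L b) = inner ℝ (L a) b := hL a b
  rw [e1, e2] at h
  have h2 : 0 ≤ 1 / (4 * c) * (2 * c * (2 * c * inner ℝ a (L a)) - 2 * c * inner ℝ (L a) b
      - (2 * c * inner ℝ (L a) b - inner ℝ b (L b))) := by
    refine mul_nonneg (by positivity) (by linarith)
  have h3 : 1 / (4 * c) * (2 * c * (2 * c * inner ℝ a (L a)) - 2 * c * inner ℝ (L a) b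
      - (2 * c * inner ℝ (L a) b - inner ℝ b (L b))) =
      c * inner ℝ a (L a) + 1 / (4 * c) * inner ℝ b (L b) - inner ℝ (L a) b := by
    field_simp; ring
  linarith

/-- The terms of second order in the stepsize that do not involve the change of the gradients. -/
lemma second_order_le {β γ ρ ρ₂ : ℝ} {L : H →ₗ[ℝ] H} (hβ : 0 < β) (hγ : 0 < γ) (hρ0 : 0 < ρ)
    (hρ : ∀ a, ‖L a‖ ^ 2 ≤ ρ * inner ℝ a (L a)) {z : H}
    (hz : ρ₂ * ‖z‖ ^ 2 ≤ inner ℝ z (L z)) (q : H) :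
    1 / 2 * ‖β • L z + q‖ ^ 2 - γ * inner ℝ q z + (γ ^ 2 - β * γ) / 2 * inner ℝ z (L z) ≤
      ‖q‖ ^ 2 + (β ^ 2 * ρ ^ 2 - 3 / 2 * β * γ * ρ₂ + γ ^ 2 / 2 + γ ^ 2 * ρ / 2) * ‖z‖ ^ 2 := by
  -- The terms linear in `q` combine to `⟨q, βLz - γz⟩`. A single completed square for both keeps
  -- the favourable `-βγ ⟨z, Lz⟩` from expanding `‖βLz - γz‖²`.
  have h1 : 0 ≤ ‖q - (β • L z - γ • z)‖ ^ 2 := sq_nonneg _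
  have hzL := inner_le_of_norm_sq_le hρ hρ0 z
  have hc : inner ℝ (L z) z = inner ℝ z (L z) := real_inner_comm _ _
  have hc2 : inner ℝ (L z) q = inner ℝ q (L z) := real_inner_comm _ _
  have hc3 : inner ℝ z q = inner ℝ q z := real_inner_comm _ _
  simp only [← real_inner_self_eq_norm_sq, inner_add_left, inner_add_right, inner_sub_left,
    inner_sub_right, real_inner_smul_left, real_inner_smul_right, hc, hc2, hc3] at h1 ⊢
  have hLz := hρ z
  simp only [← real_inner_self_eq_norm_sq] at hLz hzL hz
  have k1 : β ^ 2 * inner ℝ (L z) (L z) ≤ β ^ 2 * (ρ * (ρ * inner ℝ z z)) := by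
    gcongr
    exact hLz.trans (by gcongr)
  have k2 : γ ^ 2 / 2 * inner ℝ z (L z) ≤ γ ^ 2 / 2 * (ρ * inner ℝ z z) := by gcongr
  have k3 : 3 / 2 * (β * γ) * (ρ₂ * inner ℝ z z) ≤ 3 / 2 * (β * γ) * inner ℝ z (L z) := by gcongr
  nlinarith

/-- The terms of first order in the stepsize that do not involve the change of the gradients. -/
lemma first_order_le {β γ ρ ρ₂ ℓ : ℝ} (hβ : 0 < β) (hγ : 0 < γ) (hρ₂ : 0 < ρ₂) (hρ0 : 0 < ρ)
    {L : H →ₗ[ℝ] H}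
    (hL : ∀ a b, inner ℝ a (L b) = inner ℝ (L a) b) (hpsd : ∀ a, 0 ≤ inner ℝ a (L a))
    (hρ : ∀ a, ‖L a‖ ^ 2 ≤ ρ * inner ℝ a (L a)) {x e u h : H}
    (hx : ρ₂ * ‖x‖ ^ 2 ≤ inner ℝ x (L x)) (hu : ρ₂ * ‖u‖ ^ 2 ≤ inner ℝ u (L u))
    (hh : ‖h‖ ^ 2 ≤ ℓ ^ 2 * ‖x‖ ^ 2) :
    - β * inner ℝ x (L (x - e)) + γ * inner ℝ x (x - e) - γ * inner ℝ (L u) e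
        - γ * inner ℝ u (L u) - inner ℝ x h - inner ℝ h u ≤
      (-(1 / 2 * (ρ₂ * β)) + 3 / 2 * γ + 1 / 2 + ℓ ^ 2) * ‖x‖ ^ 2
      + (-(3 / 4 * γ) + 1 / 2 * ρ₂⁻¹) * inner ℝ u (L u)
      + ((ρ + 1 / 2) * γ + 1 / 2 * ρ * β) * ‖e‖ ^ 2 := by
  set W := inner ℝ u (L u)
  set X := ‖x‖ ^ 2
  set Y := ‖e‖ ^ 2
  have hw : ‖L u‖ ^ 2 ≤ ρ * W := hρ u
  have hu2 : ‖u‖ ^ 2 ≤ ρ₂⁻¹ * W := by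
    rw [← div_eq_inv_mul, le_div_iff₀ hρ₂]; linarith
  -- Positivity of the form of `L` at `x - e` gives `-⟨x, L(x - e)⟩ ≤ -½⟨x, Lx⟩ + ½⟨e, Le⟩`.
  have B1 : -β * inner ℝ x (L (x - e)) ≤ β * (-(ρ₂ / 2) * X + ρ / 2 * Y) := by
    have h1 := hpsd (x - e)
    have h2 := inner_le_of_norm_sq_le hρ hρ0 e
    have h3 : inner ℝ e (L x) = inner ℝ x (L e) := by rw [hL, real_inner_comm]
    simp only [map_sub, inner_sub_left, inner_sub_right, h3] at h1 ⊢
    rw [neg_mul, ← mul_neg]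
    gcongr
    linarith
  have B2 : γ * inner ℝ x (x - e) ≤ γ * (3 / 2 * X + 1 / 2 * Y) := by
    have h1 := (abs_le.1 (abs_inner_le_add_sq x e (c := 1 / 2) (by norm_num))).1
    rw [inner_sub_right, real_inner_self_eq_norm_sq]
    have : 1 / (4 * (1 / 2)) = (1 / 2 : ℝ) := by norm_num
    rw [this] at h1
    gcongr
    linarith
  have B3 : -(γ * inner ℝ (L u) e) ≤ γ * (1 / 4 * W + ρ * Y) := by
    have h1 := (abs_le.1 (abs_inner_le_add_sq (L u) e (c := 1 / (4 * ρ)) (by positivity))).1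
    have h2 : 1 / (4 * ρ) * ‖L u‖ ^ 2 ≤ 1 / (4 * ρ) * (ρ * W) := by gcongr
    have h3 : 1 / (4 * ρ) * (ρ * W) = 1 / 4 * W := by field_simp
    have h4 : 1 / (4 * (1 / (4 * ρ))) = ρ := by field_simp
    rw [h4] at h1
    rw [← mul_neg]
    gcongr
    linarith
  have B4 : -inner ℝ x h ≤ 1 / 2 * X + 1 / 2 * (ℓ ^ 2 * X) := by
    have h1 := (abs_le.1 (abs_inner_le_add_sq x h (c := 1 / 2) (by norm_num))).1
    have : 1 / (4 * (1 / 2)) = (1 / 2 : ℝ) := by norm_num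
    rw [this] at h1
    linarith
  have B5 : -inner ℝ h u ≤ 1 / 2 * (ℓ ^ 2 * X) + 1 / 2 * (ρ₂⁻¹ * W) := by
    have h1 := (abs_le.1 (abs_inner_le_add_sq h u (c := 1 / 2) (by norm_num))).1
    have : 1 / (4 * (1 / 2)) = (1 / 2 : ℝ) := by norm_num
    rw [this] at h1
    linarith
  linarith

/-- The terms that involve the change `L r` of the gradients. -/
lemma gradient_change_le {β γ α ρ ρ₂ ℓ G : ℝ} (hβ : 0 < β) (hγ : 0 < γ) (hα : 0 < α)
    (hρ₂ : 0 < ρ₂) {L : H →ₗ[ℝ] H}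
    (hL : ∀ a b, inner ℝ a (L b) = inner ℝ (L a) b) (hpsd : ∀ a, 0 ≤ inner ℝ a (L a))
    (hρ : ∀ a, ‖L a‖ ^ 2 ≤ ρ * inner ℝ a (L a)) {x e u h r : H}
    (hr : ρ₂ * ‖r‖ ^ 2 ≤ inner ℝ r (L r)) (hz2 : ‖x - e‖ ^ 2 ≤ 2 * ‖x‖ ^ 2 + 2 * ‖e‖ ^ 2)
    (hh : ‖h‖ ^ 2 ≤ ℓ ^ 2 * ‖x‖ ^ 2) (hD : ‖L r‖ ^ 2 ≤ ℓ ^ 2 * α ^ 2 * G) :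
    γ⁻¹ * inner ℝ x r + (β + γ) / γ ^ 2 * inner ℝ (L u) r + α * inner ℝ (x - e) (L r)
        - α * inner ℝ (L u) r - α / γ * inner ℝ h r
        + (β + γ) / (2 * γ ^ 3) * inner ℝ r (L r) ≤
      (α * (1 / 2) + α ^ 2 * (1 + 1 / 2 * ℓ ^ 2)) * ‖x‖ ^ 2
      + (α * (γ / 4) + α ^ 2 * (1 / 2 * ρ)) * inner ℝ u (L u)
      + α ^ 2 * ‖e‖ ^ 2
      + α * (((β + γ) ^ 2 / γ ^ 5 * ρ₂⁻¹ * ℓ ^ 2 + 1 / (2 * γ ^ 2) * (ρ₂⁻¹) ^ 2 * ℓ ^ 2)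
          + α * ((β + γ) / (2 * γ ^ 3) * ρ₂⁻¹ * ℓ ^ 2 + 1 / (2 * γ ^ 2) * (ρ₂⁻¹) ^ 2 * ℓ ^ 2
            + (ρ₂⁻¹) ^ 2 / 2 * ℓ ^ 2 + ℓ ^ 2 / 2)) * G := by
  set W := inner ℝ u (L u)
  set X := ‖x‖ ^ 2
  set Y := ‖e‖ ^ 2
  have hw : ‖L u‖ ^ 2 ≤ ρ * W := hρ u
  have hr2 : ‖r‖ ^ 2 ≤ (ρ₂⁻¹) ^ 2 * (ℓ ^ 2 * α ^ 2 * G) :=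
    (norm_sq_le_inv_sq_mul hρ₂ hr).trans (by gcongr)
  have hrD : inner ℝ r (L r) ≤ ρ₂⁻¹ * (ℓ ^ 2 * α ^ 2 * G) :=
    (inner_le_inv_mul_norm_sq hρ₂ hr).trans (by gcongr)
  -- No factor `α` stands in front, but `‖r‖²` is of order `α² G`; a Young weight proportional to
  -- `α` makes both resulting terms of order `α`.
  have B7 : γ⁻¹ * inner ℝ x r ≤
      α * (1 / 2 * X) + α * (1 / (2 * γ ^ 2) * (ρ₂⁻¹) ^ 2 * ℓ ^ 2 * G) := by
    have h1 := (abs_le.1 (abs_inner_le_add_sq x r (c := α * γ / 2) (by positivity))).2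
    have h2 : γ⁻¹ * inner ℝ x r ≤ γ⁻¹ * (α * γ / 2 * X +
        1 / (4 * (α * γ / 2)) * ((ρ₂⁻¹) ^ 2 * (ℓ ^ 2 * α ^ 2 * G))) := by
      gcongr
      refine h1.trans ?_
      gcongr
    refine h2.trans (le_of_eq ?_)
    field_simp
    ring
  -- Cauchy–Schwarz for the form of `L` costs one factor `ρ₂⁻¹` instead of two. The weight is chosen
  -- to spend exactly `γ / 4` of the dual decrease.
  have B8 : (β + γ) / γ ^ 2 * inner ℝ (L u) r ≤
      α * (γ / 4 * W) + α * ((β + γ) ^ 2 / γ ^ 5 * ρ₂⁻¹ * ℓ ^ 2 * G) := by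
    have h1 := inner_map_le_of_psd hL hpsd u r (c := α * γ ^ 3 / (4 * (β + γ))) (by positivity)
    have h2 : (β + γ) / γ ^ 2 * inner ℝ (L u) r ≤ (β + γ) / γ ^ 2 *
        (α * γ ^ 3 / (4 * (β + γ)) * W +
        1 / (4 * (α * γ ^ 3 / (4 * (β + γ)))) * (ρ₂⁻¹ * (ℓ ^ 2 * α ^ 2 * G))) := by
      gcongr
      refine h1.trans ?_
      gcongr
    refine h2.trans (le_of_eq ?_)
    field_simp
  have B9 : α * inner ℝ (x - e) (L r) ≤ α ^ 2 * (X + Y) + α ^ 2 * (ℓ ^ 2 / 2 * G) := by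
    have h1 := (abs_le.1 (abs_inner_le_add_sq (x - e) (L r) (c := α / 2) (by positivity))).2
    have h2 : α * inner ℝ (x - e) (L r) ≤ α * (α / 2 * (2 * X + 2 * Y) +
        1 / (4 * (α / 2)) * (ℓ ^ 2 * α ^ 2 * G)) := by
      gcongr
      refine h1.trans ?_
      gcongr
    refine h2.trans (le_of_eq ?_)
    field_simp
    ring
  have B10 : -(α * inner ℝ (L u) r) ≤
      α ^ 2 * (1 / 2 * ρ * W) + α ^ 2 * ((ρ₂⁻¹) ^ 2 / 2 * ℓ ^ 2 * G) := by
    have h1 := (abs_le.1 (abs_inner_le_add_sq (L u) r (c := α / 2) (by positivity))).1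
    have h2 : α * (-inner ℝ (L u) r) ≤ α * (α / 2 * (ρ * W) +
        1 / (4 * (α / 2)) * ((ρ₂⁻¹) ^ 2 * (ℓ ^ 2 * α ^ 2 * G))) := by
      gcongr
      refine (neg_le.1 h1).trans ?_
      gcongr
    rw [← mul_neg]
    refine h2.trans (le_of_eq ?_)
    field_simp
    ring
  have B11 : -(α / γ * inner ℝ h r) ≤
      α ^ 2 * (1 / 2 * ℓ ^ 2 * X) + α ^ 2 * (1 / (2 * γ ^ 2) * (ρ₂⁻¹) ^ 2 * ℓ ^ 2 * G) := by
    have h1 := (abs_le.1 (abs_inner_le_add_sq h r (c := α * γ / 2) (by positivity))).1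
    have h2 : α / γ * (-inner ℝ h r) ≤ α / γ * (α * γ / 2 * (ℓ ^ 2 * X) +
        1 / (4 * (α * γ / 2)) * ((ρ₂⁻¹) ^ 2 * (ℓ ^ 2 * α ^ 2 * G))) := by
      gcongr
      refine (neg_le.1 h1).trans ?_
      gcongr
    rw [← mul_neg]
    refine h2.trans (le_of_eq ?_)
    field_simp
    ring
  have B12 : (β + γ) / (2 * γ ^ 3) * inner ℝ r (L r) ≤
      α ^ 2 * ((β + γ) / (2 * γ ^ 3) * ρ₂⁻¹ * ℓ ^ 2 * G) := by
    have h2 : (β + γ) / (2 * γ ^ 3) * inner ℝ r (L r) ≤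
        (β + γ) / (2 * γ ^ 3) * (ρ₂⁻¹ * (ℓ ^ 2 * α ^ 2 * G)) := by gcongr
    refine h2.trans (le_of_eq ?_)
    ring
  linarith

lemma quadLyapunov_step_le {β γ α ρ ρ₂ ℓ G : ℝ} (hβ : 0 < β) (hγ : 0 < γ) (hα : 0 < α)
    (hρ₂ : 0 < ρ₂) (hρρ : 4 * γ ≤ β * ρ₂) (hρρ' : ρ₂ ≤ ρ) {L : H →ₗ[ℝ] H}
    (hL : ∀ a b, inner ℝ a (L b) = inner ℝ (L a) b) (hpsd : ∀ a, 0 ≤ inner ℝ a (L a))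
    (hρ : ∀ a, ‖L a‖ ^ 2 ≤ ρ * inner ℝ a (L a)) {x e u h r : H}
    (hx : ρ₂ * ‖x‖ ^ 2 ≤ inner ℝ x (L x)) (hz : ρ₂ * ‖x - e‖ ^ 2 ≤ inner ℝ (x - e) (L (x - e)))
    (hu : ρ₂ * ‖u‖ ^ 2 ≤ inner ℝ u (L u)) (hr : ρ₂ * ‖r‖ ^ 2 ≤ inner ℝ r (L r))
    (hh : ‖h‖ ^ 2 ≤ ℓ ^ 2 * ‖x‖ ^ 2) (hD : ‖L r‖ ^ 2 ≤ ℓ ^ 2 * α ^ 2 * G) :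
    quadLyapunov β γ L (x - α • (β • L (x - e) + γ • L u + h))
        (u + (α * γ) • (x - e) + γ⁻¹ • r) ≤
      quadLyapunov β γ L x u
      - α * ((1 / 2 * (ρ₂ * β - (3 * γ + 2 + 2 * ℓ ^ 2)))
          - α * (3 * ρ ^ 2 * β ^ 2 - ρ₂ * β * γ + (ρ + 2) * γ ^ 2 + 1 + 5 / 2 * ℓ ^ 2)) * ‖x‖ ^ 2
      - α * ((γ / 2 - 5 / 2 * ρ₂⁻¹) - α * (2 * ρ * γ ^ 2 + 1 / 2 * ρ)) * inner ℝ u (L u)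
      + α * (((ρ + 1) * γ + 1 / 2 * ρ * β)
          + α * (3 * ρ ^ 2 * β ^ 2 + (ρ - 2 * ρ₂) * β * γ + (ρ + 2) * γ ^ 2 + 1)) * ‖e‖ ^ 2
      + α * (((β + γ) ^ 2 / γ ^ 5 * ρ₂⁻¹ * ℓ ^ 2 + 1 / (2 * γ ^ 2) * (ρ₂⁻¹) ^ 2 * ℓ ^ 2)
          + α * ((β + γ) / (2 * γ ^ 3) * ρ₂⁻¹ * ℓ ^ 2 + 1 / (2 * γ ^ 2) * (ρ₂⁻¹) ^ 2 * ℓ ^ 2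
            + (ρ₂⁻¹) ^ 2 / 2 * ℓ ^ 2 + ℓ ^ 2 / 2)) * G := by
  have hρ0 : 0 < ρ := hρ₂.trans_le hρρ'
  rw [quadLyapunov_step_eq hγ.ne' hL x (x - e) u h r, sub_sub_cancel]
  have hz2 : ‖x - e‖ ^ 2 ≤ 2 * ‖x‖ ^ 2 + 2 * ‖e‖ ^ 2 := by
    have h1 := parallelogram_law_with_norm ℝ x e
    linarith [mul_self_nonneg ‖x + e‖, sq ‖x - e‖, sq ‖x‖, sq ‖e‖]
  have hq : ‖γ • L u + h‖ ^ 2 ≤ 2 * (γ ^ 2 * (ρ * inner ℝ u (L u))) + 2 * (ℓ ^ 2 * ‖x‖ ^ 2) := by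
    have h1 := parallelogram_law_with_norm ℝ (γ • L u) h
    have h2 : ‖γ • L u‖ ^ 2 ≤ γ ^ 2 * (ρ * inner ℝ u (L u)) := by
      rw [norm_smul, mul_pow, Real.norm_eq_abs, sq_abs]
      have := hρ u
      gcongr
    linarith [mul_self_nonneg ‖γ • L u - h‖, sq ‖γ • L u + h‖, sq ‖γ • L u‖, sq ‖h‖]
  have K1 := first_order_le hβ hγ hρ₂ hρ0 hL hpsd hρ (e := e) hx hu hh
  have K2 := second_order_le (β := β) (γ := γ) hβ hγ hρ0 hρ hz (γ • L u + h)
  have K3 := gradient_change_le hβ hγ hα hρ₂ hL hpsd hρ (u := u) hr hz2 hh hD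
  set W := inner ℝ u (L u)
  set X := ‖x‖ ^ 2
  set Y := ‖e‖ ^ 2
  have hX0 : 0 ≤ X := sq_nonneg _
  have hY0 : 0 ≤ Y := sq_nonneg _
  have hW0 : 0 ≤ W := hpsd u
  -- The sign is needed to replace `‖x - e‖²` by its upper bound; it holds because `4γ ≤ βρ₂ ≤ βρ`
  -- lets `β²ρ²` absorb the negative term.
  have hcoef : 0 ≤ β ^ 2 * ρ ^ 2 - 3 / 2 * β * γ * ρ₂ + γ ^ 2 / 2 + γ ^ 2 * ρ / 2 := by
    have h1 : β * ρ₂ ≤ β * ρ := by gcongr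
    nlinarith [mul_pos hβ hρ0, mul_pos hβ hρ₂]
  have K4 := K2.trans (add_le_add hq (mul_le_mul_of_nonneg_left hz2 hcoef))
  have K5 := mul_le_mul_of_nonneg_left K4 (sq_nonneg α)
  have K6 := mul_le_mul_of_nonneg_left K1 hα.le
  -- `s1` to `s4` are the exact amounts by which the stated coefficients exceed those produced by
  -- `K3`, `K5` and `K6`.
  have s1 : 0 ≤ α ^ 2 * (ρ ^ 2 * β ^ 2 + 2 * ρ₂ * β * γ + γ ^ 2) * X := by positivity
  have s2 : 0 ≤ α * (2 * ρ₂⁻¹) * W := by positivity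
  have s3 : 0 ≤ α * (1 / 2 * γ) * Y := by positivity
  have s4 : 0 ≤ α ^ 2 * (ρ ^ 2 * β ^ 2 + (ρ + ρ₂) * β * γ + γ ^ 2) * Y := by positivity
  linarith

end UnifiedCompression

end

/-! ### Smoothness, averages and descent of the global cost. -/

noncomputable section

namespace UnifiedCompression

/-- Quadratic upper bound for a function with Lipschitz gradient. -/
lemma le_add_inner_gradient_add_sq {H : Type*} [NormedAddCommGroup H] [InnerProductSpace ℝ H]
    [CompleteSpace H] {φ : H → ℝ} {ℓ : ℝ} (hφ : Differentiable ℝ φ)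
    (hlip : ∀ x y, ‖gradient φ x - gradient φ y‖ ≤ ℓ * ‖x - y‖) (x h : H) :
    φ (x + h) ≤ φ x + inner ℝ (gradient φ x) h + ℓ / 2 * ‖h‖ ^ 2 := by
  -- `φ` along the segment minus the quadratic model, up to the constant `φ x`; the Lipschitz bound
  -- makes its derivative nonpositive.
  let ψ : ℝ → ℝ := fun t => φ (x + t • h) - t * inner ℝ (gradient φ x) h - ℓ / 2 * ‖h‖ ^ 2 * t ^ 2
  have hd : ∀ t, HasDerivAt ψ (inner ℝ (gradient φ (x + t • h)) h - inner ℝ (gradient φ x) h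
      - ℓ / 2 * ‖h‖ ^ 2 * (2 * t)) t := by
    intro t
    have h1 : HasDerivAt (fun t : ℝ => x + t • h) h t := by
      simpa using ((hasDerivAt_id t).smul_const h).const_add x
    have h2 := (hφ (x + t • h)).hasFDerivAt.comp_hasDerivAt t h1
    rw [← inner_gradient_left] at h2
    have h3 : HasDerivAt (fun t : ℝ => t * inner ℝ (gradient φ x) h)
        (inner ℝ (gradient φ x) h) t := by
      simpa using (hasDerivAt_id t).mul_const (inner ℝ (gradient φ x) h)
    have h4 : HasDerivAt (fun t : ℝ => ℓ / 2 * ‖h‖ ^ 2 * t ^ 2) (ℓ / 2 * ‖h‖ ^ 2 * (2 * t)) t := by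
      simpa using (hasDerivAt_pow 2 t).const_mul (ℓ / 2 * ‖h‖ ^ 2)
    exact (h2.sub h3).sub h4
  have hanti : AntitoneOn ψ (Set.Icc 0 1) := by
    refine antitoneOn_of_deriv_nonpos (convex_Icc 0 1)
      (fun t _ => (hd t).continuousAt.continuousWithinAt)
      (fun t _ => (hd t).differentiableAt.differentiableWithinAt) fun t ht => ?_
    rw [interior_Icc] at ht
    rw [(hd t).deriv, ← inner_sub_left]
    have h1 := real_inner_le_norm (gradient φ (x + t • h) - gradient φ x) h
    have h2 := hlip (x + t • h) x
    rw [add_sub_cancel_left, norm_smul, Real.norm_eq_abs, abs_of_pos ht.1] at h2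
    have h3 := mul_le_mul_of_nonneg_right h2 (norm_nonneg h)
    linarith [h1.trans h3, (by ring : ℓ * (t * ‖h‖) * ‖h‖ = ℓ / 2 * ‖h‖ ^ 2 * (2 * t))]
  have h01 := hanti (Set.left_mem_Icc.2 zero_le_one) (Set.right_mem_Icc.2 zero_le_one) zero_le_one
  simp only [ψ, one_smul, zero_smul, add_zero, one_mul, zero_mul] at h01
  linarith

/-- Norm of the gradient of a smooth function bounded below. -/
lemma norm_gradient_sq_le {H : Type*} [NormedAddCommGroup H] [InnerProductSpace ℝ H]
    [CompleteSpace H] {φ : H → ℝ} {ℓ m : ℝ} (hℓ : 0 < ℓ) (hφ : Differentiable ℝ φ)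
    (hlip : ∀ x y, ‖gradient φ x - gradient φ y‖ ≤ ℓ * ‖x - y‖) (hm : ∀ x, m ≤ φ x) (x : H) :
    ‖gradient φ x‖ ^ 2 ≤ 2 * ℓ * (φ x - m) := by
  -- The gradient step of length `1 / ℓ` minimizes the quadratic upper bound.
  have h1 := le_add_inner_gradient_add_sq hφ hlip x (-(ℓ⁻¹ • gradient φ x))
  rw [inner_neg_right, real_inner_smul_right, real_inner_self_eq_norm_sq, norm_neg, norm_smul,
    mul_pow, Real.norm_eq_abs, sq_abs] at h1
  have h2 := (hm _).trans h1
  have h3 : ℓ * (ℓ / 2 * (ℓ⁻¹ ^ 2 * ‖gradient φ x‖ ^ 2)) = 1 / 2 * ‖gradient φ x‖ ^ 2 := by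
    field_simp
  have h4 : ℓ * (ℓ⁻¹ * ‖gradient φ x‖ ^ 2) = ‖gradient φ x‖ ^ 2 := by field_simp
  have h5 := mul_le_mul_of_nonneg_left h2 hℓ.le
  linarith

namespace Setting

variable {n d : ℕ} (S : Setting n d)

lemma differentiable_F (hs : S.Smooth) : Differentiable ℝ S.F := by
  unfold F
  have := hs.differentiable
  fun_prop

lemma gradient_F (hs : S.Smooth) (x : Vec d) :
    gradient S.F x = avg fun i => gradient (S.f i) x := by
  refine HasGradientAt.gradient ?_
  rw [hasGradientAt_iff_hasFDerivAt]
  have h1 : HasFDerivAt (fun y => ∑ i, S.f i y) (∑ i, fderiv ℝ (S.f i) x) x :=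
    HasFDerivAt.fun_sum fun i _ => (hs.differentiable i x).hasFDerivAt
  have h2 := h1.const_mul (1 / (n : ℝ))
  have h3 : (InnerProductSpace.toDual ℝ (Vec d)) (avg fun i => gradient (S.f i) x) =
      (1 / (n : ℝ)) • ∑ i, fderiv ℝ (S.f i) x := by
    rw [avg, map_smulₛₗ, map_sum, conj_trivial]
    simp only [toDual_gradient]
  rw [h3]
  exact h2

/-- Jensen's inequality for the squared norm of an average. -/
lemma norm_avg_sq_le (hn : n ≠ 0) (x : Fin n → Vec d) :
    n * ‖avg x‖ ^ 2 ≤ ‖stack x‖ ^ 2 := by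
  have hn0 : (0 : ℝ) < n := by positivity
  have h1 : ‖∑ i, x i‖ ^ 2 ≤ n * ∑ i, ‖x i‖ ^ 2 := by
    calc ‖∑ i, x i‖ ^ 2 ≤ (∑ i, ‖x i‖) ^ 2 := by
          gcongr; exact norm_sum_le _ _
      _ ≤ _ := by simpa using sq_sum_le_card_mul_sum_sq (s := Finset.univ) (f := fun i => ‖x i‖)
  rw [PiLp.norm_sq_eq_of_L2 _ (stack x), avg, norm_smul, mul_pow, Real.norm_eq_abs, sq_abs]
  calc (n : ℝ) * ((1 / (n : ℝ)) ^ 2 * ‖∑ i, x i‖ ^ 2)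
      ≤ n * ((1 / (n : ℝ)) ^ 2 * (n * ∑ i, ‖x i‖ ^ 2)) := by gcongr
    _ = _ := by field_simp

lemma avg_sub (x y : Fin n → Vec d) : avg (fun i => x i - y i) = avg x - avg y := by
  simp [avg, Finset.sum_sub_distrib, smul_sub]

lemma avg_const (hn : n ≠ 0) (c : Vec d) : avg (fun _ : Fin n => c) = c := by
  have hn0 : (n : ℝ) ≠ 0 := by positivity
  rw [avg, Finset.sum_const, Finset.card_univ, Fintype.card_fin, ← Nat.cast_smul_eq_nsmul ℝ,
    smul_smul, one_div_mul_cancel hn0, one_smul]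

lemma gradient_F_lipschitz (hn : n ≠ 0) (hs : S.Smooth) (x y : Vec d) :
    ‖gradient S.F x - gradient S.F y‖ ≤ S.ℓ * ‖x - y‖ := by
  have hn0 : (n : ℝ) ≠ 0 := by positivity
  rw [S.gradient_F hs, S.gradient_F hs, ← avg_sub, avg, norm_smul, Real.norm_eq_abs,
    abs_of_nonneg (by positivity)]
  calc 1 / (n : ℝ) * ‖∑ i, (gradient (S.f i) x - gradient (S.f i) y)‖
      ≤ 1 / (n : ℝ) * ∑ i : Fin n, S.ℓ * ‖x - y‖ := by
        gcongr
        exact (norm_sum_le _ _).trans (Finset.sum_le_sum fun i _ => hs.lipschitz i x y)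
    _ = _ := by
        rw [Finset.sum_const, Finset.card_univ, Fintype.card_fin, nsmul_eq_mul]; field_simp

lemma fStar_le (hopt : S.FiniteOptimum) (x : Vec d) : S.fStar ≤ S.F x := ciInf_le hopt x

/-- The local gradients, stacked, at the blocks of `x`. -/
def grad (x : Stack n d) : Stack n d := stack fun i => gradient (S.f i) (x i)

lemma norm_grad_sub_sq_le (hs : S.Smooth) (x y : Stack n d) :
    ‖S.grad x - S.grad y‖ ^ 2 ≤ S.ℓ ^ 2 * ‖x - y‖ ^ 2 := by
  rw [PiLp.norm_sq_eq_of_L2, PiLp.norm_sq_eq_of_L2, Finset.mul_sum]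
  refine Finset.sum_le_sum fun i _ => ?_
  rw [← mul_pow]
  exact pow_le_pow_left₀ (norm_nonneg _) (hs.lipschitz i (x i) (y i)) 2

/-- The stacked vector all of whose blocks are the average of the blocks of `x`. -/
def avgStack (x : Stack n d) : Stack n d := stack fun _ => avg x

lemma sub_avgStack (x : Stack n d) : x - avgStack x = kron d (centerMat n) x := by
  ext i a
  rw [kron_centerMat_apply]
  simp [avgStack]

lemma norm_stack_const_sq (c : Vec d) : ‖stack fun _ : Fin n => c‖ ^ 2 = n * ‖c‖ ^ 2 := by
  rw [PiLp.norm_sq_eq_of_L2]; simp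

/-- Pythagoras for the splitting into average and centered part. -/
lemma norm_sq_eq_center_add (hn : n ≠ 0) (x : Stack n d) :
    ‖x‖ ^ 2 = ‖kron d (centerMat n) x‖ ^ 2 + n * ‖avg x‖ ^ 2 := by
  have h1 : x = kron d (centerMat n) x + avgStack x := by rw [← sub_avgStack]; abel
  have h2 : inner ℝ (kron d (centerMat n) x) (avgStack x) = 0 := by
    have h3 : kron d (centerMat n) (avgStack x) = 0 := by
      rw [← sub_avgStack, sub_eq_zero]
      simp only [avgStack, avg_const hn]
    rw [← inner_kron_centerMat, h3, inner_zero_right]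
  have h4 := norm_add_sq_real (kron d (centerMat n) x) (avgStack x)
  rw [← h1, h2] at h4
  rw [h4, avgStack, norm_stack_const_sq]; ring

lemma norm_center_le (hn : n ≠ 0) (x : Stack n d) : ‖kron d (centerMat n) x‖ ^ 2 ≤ ‖x‖ ^ 2 := by
  rw [norm_sq_eq_center_add hn x]
  have : 0 ≤ (n : ℝ) * ‖avg x‖ ^ 2 := by positivity
  linarith

/-- Descent of the global cost along the averaged gradient. -/
lemma F_step_le (hn : n ≠ 0) (hs : S.Smooth) {α : ℝ} (hα : 0 < α) (x : Stack n d) :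
    n * S.F (avg x - α • avg (S.grad x)) ≤ n * S.F (avg x)
      - α / 2 * (n * ‖gradient S.F (avg x)‖ ^ 2)
      - α * (1 / 2 - α * (S.ℓ / 2)) * (n * ‖avg (S.grad x)‖ ^ 2)
      + α / 2 * (S.ℓ ^ 2 * ‖kron d (centerMat n) x‖ ^ 2) := by
  have h1 := le_add_inner_gradient_add_sq (S.differentiable_F hs) (S.gradient_F_lipschitz hn hs)
    (avg x) (-(α • avg (S.grad x)))
  rw [← sub_eq_add_neg, inner_neg_right, real_inner_smul_right, norm_neg, norm_smul, mul_pow,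
    Real.norm_eq_abs, sq_abs] at h1
  -- Polarization of the inner product keeps two negative squares: `‖∇F(x̄)‖²` for the
  -- Polyak–Łojasiewicz inequality and the squared averaged gradient to pay for the dual drift.
  have h2 := norm_sub_sq_real (gradient S.F (avg x)) (avg (S.grad x))
  have h3 : n * ‖gradient S.F (avg x) - avg (S.grad x)‖ ^ 2 ≤
      S.ℓ ^ 2 * ‖kron d (centerMat n) x‖ ^ 2 := by
    rw [S.gradient_F hs, ← avg_sub, ← sub_avgStack, ← norm_sub_rev]
    exact (norm_avg_sq_le hn _).trans (S.norm_grad_sub_sq_le hs (avgStack x) x)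
  have hn0 : (0 : ℝ) < n := by positivity
  have h4 := mul_le_mul_of_nonneg_left h1 hn0.le
  have h5 := mul_le_mul_of_nonneg_left h3 (by positivity : 0 ≤ α / 2)
  rw [h2] at h5
  linarith

end Setting

end UnifiedCompression

end

/-! ### Signs of the constants and consequences of admissibility. -/

noncomputable section

namespace UnifiedCompression

namespace Setting

variable {n d : ℕ} (S : Setting n d)

/-- Sign and size conditions on the parameters that follow from the assumptions. -/
structure Gains : Prop where
  n_pos : (0 : ℝ) < n
  ρ₂_pos : 0 < S.ρ₂
  ρ₂_le_ρ : S.ρ₂ ≤ S.ρ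
  ℓ_pos : 0 < S.ℓ
  ν_pos : 0 < S.ν
  two_lt_γ : 2 < S.γ
  four_lt : 4 < S.τ₁ * S.ρ₂
  ε₅_pos : 0 < S.ε₅
  two_mul_ε₅_le : 2 * S.ε₅ ≤ 1
  dHat_pos : 0 < S.dHat
  dTilde_pos : 0 < S.dTilde

lemma gains (hn : 2 ≤ n) (hd : 1 ≤ d) (hcomp : S.LocallyBounded) (hgraph : S.UndirectedConnected)
    (hsmooth : S.Smooth) (hPL : S.PolyakLojasiewicz) (hτ : S.κ₁ < S.τ₁) (hγ : S.κ₂ < S.γ)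
    (hω : 0 < S.ω) (hω' : S.ω ≤ 1 / S.r) : S.Gains where
  n_pos := by positivity
  ρ₂_pos := S.ρ₂_pos hn hgraph
  ρ₂_le_ρ := S.ρ₂_le_ρ hn hgraph
  ℓ_pos := hsmooth.ℓ_pos
  ν_pos := hPL.ν_pos
  two_lt_γ := by
    have h : 2 + 2 * S.ℓ ^ 2 ≤ S.κ₂ := (le_max_left _ _).trans (le_max_left _ _)
    nlinarith [sq_nonneg S.ℓ]
  four_lt := by rwa [κ₁, div_lt_iff₀ (S.ρ₂_pos hn hgraph)] at hτ
  ε₅_pos := by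
    have h1 := hcomp.δ_pos
    have h2 := hcomp.δ_le
    have h3 : 0 < S.δ - S.δ ^ 2 / 2 := by nlinarith
    exact mul_pos (mul_pos hω hcomp.r_pos) h3
  two_mul_ε₅_le := by
    have h1 : S.ω * S.r ≤ 1 := by rwa [le_div_iff₀ hcomp.r_pos] at hω'
    have h2 : 0 ≤ S.ω * S.r := (mul_pos hω hcomp.r_pos).le
    have h3 : 2 * (S.δ - S.δ ^ 2 / 2) ≤ 1 := by nlinarith [sq_nonneg (S.δ - 1)]
    unfold ε₅
    nlinarith
  dHat_pos := S.dHat_pos hd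
  dTilde_pos := S.dTilde_pos hd

namespace Gains

variable {S} (h : S.Gains)
include h

lemma ρ_pos : 0 < S.ρ := h.ρ₂_pos.trans_le h.ρ₂_le_ρ

lemma γ_pos : 0 < S.γ := two_pos.trans h.two_lt_γ

lemma τ₁_pos : 0 < S.τ₁ := by
  have := h.four_lt
  exact pos_of_mul_pos_left (by linarith) h.ρ₂_pos.le

lemma β_pos : 0 < S.β := mul_pos h.τ₁_pos h.γ_pos

lemma four_mul_γ_le : 4 * S.γ ≤ S.β * S.ρ₂ := by
  have := mul_le_mul_of_nonneg_right h.four_lt.le h.γ_pos.le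
  unfold β; linarith

lemma four_mul_γ_le' : 4 * S.γ ≤ S.β * S.ρ :=
  h.four_mul_γ_le.trans (mul_le_mul_of_nonneg_left h.ρ₂_le_ρ h.β_pos.le)

/-- Since `γ ≤ βρ`, the only negative term is dominated by one of the three copies of `ρ²β²`. In
`φ₈` two copies are spent in the same way. -/
lemma φ₂_pos : 0 < S.φ₂ := by
  have h1 := h.ρ_pos
  have h2 := h.γ_pos
  have h3 := h.β_pos
  have h4 : S.ρ₂ * S.β * S.γ ≤ S.ρ * S.β * (S.β * S.ρ) := by
    have := h.ρ₂_le_ρ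
    have := h.four_mul_γ_le'
    gcongr
    linarith
  have h5 : 0 < 2 * S.ρ ^ 2 * S.β ^ 2 + (S.ρ + 2) * S.γ ^ 2 + 1 + 5 / 2 * S.ℓ ^ 2 := by positivity
  unfold φ₂
  nlinarith

lemma φ₄_pos : 0 < S.φ₄ := by
  have h1 := h.ρ_pos
  unfold φ₄; positivity

lemma φ₆_pos : 0 < S.φ₆ := by
  have h1 := h.ρ₂_pos
  have h2 := h.γ_pos
  have h3 := h.β_pos
  have h4 := h.ℓ_pos
  unfold φ₆; positivity

lemma φ₇_pos : 0 < S.φ₇ := by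
  have h1 := h.ρ_pos
  have h2 := h.γ_pos
  have h3 := h.β_pos
  unfold φ₇; positivity

lemma φ₈_pos : 0 < S.φ₈ := by
  have h1 := h.ρ_pos
  have h2 := h.γ_pos
  have h3 := h.β_pos
  have h4 : S.ρ₂ * S.β * S.γ ≤ S.ρ * S.β * (S.β * S.ρ) := by
    have := h.ρ₂_le_ρ
    have := h.four_mul_γ_le'
    gcongr
    linarith
  have h5 : 0 < S.ρ ^ 2 * S.β ^ 2 + S.ρ * S.β * S.γ + (S.ρ + 2) * S.γ ^ 2 + 1 := by positivity
  unfold φ₈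
  nlinarith

lemma ε₁_eq : S.ε₁ = 1 / 2 - 1 / (2 * (S.τ₁ * S.ρ₂)) := by
  have h1 := h.τ₁_pos
  have h2 := h.ρ₂_pos
  unfold ε₁; field_simp

lemma ε₁_pos : 0 < S.ε₁ := by
  have h1 := h.τ₁_pos
  have h2 := h.ρ₂_pos
  have h3 := h.four_lt
  unfold ε₁
  exact div_pos (by linarith) (by positivity)

lemma ε₁_le : S.ε₁ ≤ 1 / 2 := by
  have h1 := h.τ₁_pos
  have h2 := h.ρ₂_pos
  rw [h.ε₁_eq]
  have : 0 < 1 / (2 * (S.τ₁ * S.ρ₂)) := by positivity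
  linarith

lemma one_le_ε₂ : 1 ≤ S.ε₂ := by
  have h3 := h.four_lt
  exact le_trans (by linarith) (le_max_left _ _)

lemma ψ₂_pos {α : ℝ} (hα : 0 < α) : 0 < S.ψ₂ α :=
  add_pos h.φ₇_pos (mul_pos hα h.φ₈_pos)

lemma ψ₃_pos : 0 < S.ψ₃ := by
  have h1 := h.ρ_pos
  have h2 := h.ε₅_pos
  have h3 := h.β_pos
  have h4 := h.dHat_pos
  unfold ψ₃; positivity

lemma ψ₄_pos : 0 < S.ψ₄ := by
  have h1 := h.ρ_pos
  have h2 := h.ε₅_pos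
  have h3 := h.γ_pos
  have h4 := h.dHat_pos
  have h5 := h.ε₁_pos
  have h6 : 0 < max (S.β ^ 2 * S.ρ ^ 2 + S.ℓ ^ 2) (S.γ ^ 2 * S.ρ) :=
    lt_max_of_lt_right (by positivity)
  unfold ψ₄; positivity

lemma φ₁_pos (hγ : S.κ₂' < S.γ) : 0 < S.φ₁ := by
  have h1 : 2 + 3 * S.ℓ ^ 2 ≤ S.κ₂' := (le_max_left _ _).trans (le_max_left _ _)
  have h2 := h.four_mul_γ_le
  unfold φ₁; nlinarith

omit h in
lemma φ₃_pos (hγ : S.κ₂' < S.γ) : 0 < S.φ₃ := by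
  have h1 : 5 / S.ρ₂ ≤ S.κ₂' := (le_max_right _ _).trans (le_max_left _ _)
  rw [div_eq_mul_inv] at h1
  unfold φ₃; linarith

/-- The cube-root and the linear threshold in `κ₂'` each bring one subtracted term below `1 / 16`.
-/
lemma φ₅_pos (hγ : S.κ₂' < S.γ) : 0 < S.φ₅ := by
  have hγ0 := h.γ_pos
  have hρ₂ := h.ρ₂_pos
  have hτ := h.τ₁_pos
  have hℓ := h.ℓ_pos
  have h1 : (16 * S.ℓ ^ 2 * (S.τ₁ + 1) ^ 2 / S.ρ₂) ^ (1 / 3 : ℝ) < S.γ :=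
    ((le_max_left _ _).trans (le_max_right _ _)).trans_lt hγ
  have h2 : 2 * √2 * S.ℓ / S.ρ₂ < S.γ :=
    ((le_max_right _ _).trans (le_max_right _ _)).trans_lt hγ
  have h3 : 16 * S.ℓ ^ 2 * (S.τ₁ + 1) ^ 2 / S.ρ₂ < S.γ ^ 3 := by
    have h4 := pow_lt_pow_left₀ h1 (by positivity) (three_ne_zero)
    rwa [← Real.rpow_natCast, ← Real.rpow_mul (by positivity), show (1 / 3 : ℝ) * ((3 : ℕ) : ℝ) = 1
      by norm_num, Real.rpow_one] at h4
  have h5 : 8 * S.ℓ ^ 2 / S.ρ₂ ^ 2 < S.γ ^ 2 := by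
    have h6 := pow_lt_pow_left₀ h2 (by positivity) (two_ne_zero)
    rw [div_pow, mul_pow, mul_pow, Real.sq_sqrt (by norm_num)] at h6
    norm_num at h6
    exact h6
  have t1 : (S.β + S.γ) ^ 2 / S.γ ^ 5 * S.ρ₂⁻¹ * S.ℓ ^ 2 < 1 / 16 := by
    have e : (S.β + S.γ) ^ 2 / S.γ ^ 5 * S.ρ₂⁻¹ * S.ℓ ^ 2 =
        (16 * S.ℓ ^ 2 * (S.τ₁ + 1) ^ 2 / S.ρ₂) / (16 * S.γ ^ 3) := by
      unfold β; field_simp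
    rw [e, div_lt_div_iff₀ (by positivity) (by norm_num)]
    linarith
  have t2 : 1 / (2 * S.γ ^ 2) * (S.ρ₂⁻¹) ^ 2 * S.ℓ ^ 2 < 1 / 16 := by
    have e : 1 / (2 * S.γ ^ 2) * (S.ρ₂⁻¹) ^ 2 * S.ℓ ^ 2 =
        (8 * S.ℓ ^ 2 / S.ρ₂ ^ 2) / (16 * S.γ ^ 2) := by
      field_simp; norm_num
    rw [e, div_lt_div_iff₀ (by positivity) (by norm_num)]
    linarith
  unfold φ₅; linarith

lemma κ₆'_pos {ψ₅ : ℝ} (hψ : 0 < ψ₅) : 0 < S.κ₆' ψ₅ := by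
  have h1 := h.ε₅_pos
  have h2 := h.ψ₃_pos
  have h3 := h.ψ₄_pos
  have h4 : 0 ≤ 1 - 2 * S.ε₅ := by linarith [h.two_mul_ε₅_le]
  unfold κ₆'
  positivity

/-- For large `γ` the admissible stepsizes include an interval `(0, αMax)`. -/
lemma exists_admissible (hγ : S.κ₂' < S.γ) :
    ∃ ψ₅ αMax : ℝ, 0 < αMax ∧ ∀ α : ℝ, 0 < α → α < αMax → S.Admissible α ψ₅ := by
  have p1 := h.φ₁_pos hγ
  have p3 := φ₃_pos hγ
  have p5 := h.φ₅_pos hγ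
  have p2 := h.φ₂_pos
  have p4 := h.φ₄_pos
  have p6 := h.φ₆_pos
  have p7 := h.φ₇_pos
  have p8 := h.φ₈_pos
  have pε := h.one_le_ε₂
  have h12 : 0 ≤ 1 - 2 * S.ε₅ := by linarith [h.two_mul_ε₅_le]
  have hκ : 0 < S.κHat₀ := lt_min (div_pos p1 p2) (lt_min (div_pos p3 p4) (div_pos p5 p6))
  -- For `α < κHat₀ / 2` at least half of `φ₁` and of `φ₃` survives in `ε₃ α`, so `e6` is a lower
  -- bound for `ε₆ α` uniform in `α`.
  set e6 := min (S.ν / 2) (min (S.φ₁ / 2) (S.φ₃ / 2)) / S.ε₂ with he6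
  have he6pos : 0 < e6 :=
    div_pos (lt_min (by linarith [h.ν_pos]) (lt_min (by linarith) (by linarith))) (by linarith)
  -- Bounds `ψ₅Low` on that whole range, which allows `ψ₅ = B + 1` to be fixed before `α`.
  set B := (1 - 2 * S.ε₅) * (S.φ₇ + S.κHat₀ * S.φ₈) / e6 with hB
  have hB0 : 0 ≤ B := by positivity
  have hk6 := h.κ₆'_pos (ψ₅ := B + 1) (by linarith)
  have hk : 0 < S.κ₆' (B + 1) / (√(n : ℝ) * S.dTilde) :=
    div_pos hk6 (mul_pos (Real.sqrt_pos.2 h.n_pos) h.dTilde_pos)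
  refine ⟨B + 1, min (S.κHat₀ / 2) (min (1 / S.φ₁) (S.κ₆' (B + 1) / (√(n : ℝ) * S.dTilde))),
    lt_min (by linarith) (lt_min (by positivity) hk), fun α hα hlt => ?_⟩
  obtain ⟨hα1, hlt⟩ := lt_min_iff.1 hlt
  obtain ⟨hα2, hα3⟩ := lt_min_iff.1 hlt
  refine ⟨hα, ?_, ?_⟩
  · refine lt_min (EReal.coe_lt_coe_iff.2 (by linarith))
      (lt_min (lt_of_lt_of_le (EReal.coe_lt_coe_iff.2 hα2) ?_) (EReal.coe_lt_coe_iff.2 hα3))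
    refine le_sInf ?_
    rintro t ⟨a, ha, hroot, rfl⟩
    refine EReal.coe_le_coe_iff.2 ?_
    -- A positive root satisfies `1 = a ε₃(a) ≤ a φ₁`, so no root lies below `1 / φ₁`.
    have h1 : S.ε₃ a ≤ S.φ₁ := (min_le_left _ _).trans (by nlinarith)
    rw [div_le_iff₀ p1, ← hroot]
    gcongr
  · have h1 : α < S.φ₁ / S.φ₂ / 2 := by
      have : S.κHat₀ ≤ S.φ₁ / S.φ₂ := min_le_left _ _
      linarith
    have h2 : α < S.φ₃ / S.φ₄ / 2 := by
      have : S.κHat₀ ≤ S.φ₃ / S.φ₄ := (min_le_right _ _).trans (min_le_left _ _)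
      linarith
    rw [div_div, lt_div_iff₀ (by positivity)] at h1 h2
    have h3 : min (S.φ₁ / 2) (S.φ₃ / 2) ≤ S.ε₃ α :=
      min_le_min (by linarith) (by linarith)
    have h4 : e6 ≤ S.ε₆ α := by
      unfold ε₆
      rw [he6]
      have := min_le_min (le_refl (S.ν / 2)) h3
      gcongr
    have h5 : S.ψ₅Low α ≤ B := by
      unfold ψ₅Low ψ₂
      rw [hB]
      gcongr
      linarith
    linarith

end Gains

/-- Consequences of the admissibility of a stepsize. -/
lemma Admissible.mul_lt {α ψ₅ : ℝ} {S : Setting n d} (h : S.Gains) (ha : S.Admissible α ψ₅) :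
    α * S.φ₂ < S.φ₁ ∧ α * S.φ₄ < S.φ₃ ∧ α * S.φ₆ < S.φ₅ := by
  have h1 : α < S.κHat₀ := EReal.coe_lt_coe_iff.1 (ha.2.1.trans_le (min_le_left _ _))
  obtain ⟨h2, h3⟩ := lt_min_iff.1 h1
  obtain ⟨h3, h4⟩ := lt_min_iff.1 h3
  exact ⟨(lt_div_iff₀ h.φ₂_pos).1 h2, (lt_div_iff₀ h.φ₄_pos).1 h3, (lt_div_iff₀ h.φ₆_pos).1 h4⟩

namespace Admissible

variable {α ψ₅ : ℝ} {S} (ha : S.Admissible α ψ₅) (h : S.Gains)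
include ha h

lemma ε₃_pos : 0 < S.ε₃ α := by
  obtain ⟨h1, h2, -⟩ := ha.mul_lt h
  exact lt_min (by linarith) (by linarith)

lemma ε₆_pos : 0 < S.ε₆ α :=
  div_pos (lt_min (by linarith [h.ν_pos]) (ha.ε₃_pos h)) (by linarith [h.one_le_ε₂])

omit h in
-- `t ε₃(t)` is continuous and vanishes at `0`; reaching `1` by `α` would put a positive root at or
-- below `α`, against `α < κ₅`. The result keeps the contraction factor `1 - α ε₆` nonnegative.
lemma mul_ε₃_lt_one : α * S.ε₃ α < 1 := by
  by_contra! hcon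
  have hκ : (α : EReal) < S.κ₅ :=
    ha.2.1.trans_le ((min_le_right _ _).trans (min_le_left _ _))
  have hc : ContinuousOn (fun t => t * S.ε₃ t) (Set.Icc 0 α) := by
    unfold ε₃
    fun_prop
  obtain ⟨a, ⟨ha0, haα⟩, hroot⟩ := intermediate_value_Icc ha.1.le hc
    (show (1 : ℝ) ∈ Set.Icc _ _ from ⟨by simp, hcon⟩)
  have hapos : 0 < a := by
    rcases ha0.eq_or_lt with h0 | h0
    · simp [← h0] at hroot
    · exact h0
  have hle : S.κ₅ ≤ (a : EReal) := sInf_le ⟨a, hapos, hroot, rfl⟩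
  exact absurd (hκ.trans_le hle) (not_lt.2 (EReal.coe_le_coe_iff.2 haα))

lemma mul_ε₆_le_one : α * S.ε₆ α ≤ 1 := by
  have h1 := ha.mul_ε₃_lt_one
  have h2 := h.one_le_ε₂
  have h3 : S.ε₆ α ≤ S.ε₃ α := by
    unfold ε₆
    rw [div_le_iff₀ (by linarith)]
    have := ha.ε₃_pos h
    nlinarith [min_le_right (S.ν / 2) (S.ε₃ α)]
  have := mul_le_mul_of_nonneg_left h3 ha.1.le
  linarith

lemma ψ₅_pos : 0 < ψ₅ := by
  have h12 : 0 ≤ 1 - 2 * S.ε₅ := by linarith [h.two_mul_ε₅_le]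
  refine lt_of_le_of_lt ?_ ha.2.2
  exact div_nonneg (mul_nonneg h12 (h.ψ₂_pos ha.1).le) (ha.ε₆_pos h).le

lemma rate_pos : 0 < S.ε₆ α - (1 - 2 * S.ε₅) * S.ψ₂ α * (1 / ψ₅) := by
  have h1 := ha.2.2
  have h2 := ha.ψ₅_pos h
  unfold ψ₅Low at h1
  rw [div_lt_iff₀ (ha.ε₆_pos h)] at h1
  rw [mul_one_div, sub_pos, div_lt_iff₀ h2]
  linarith

lemma κ₉_lt_one : S.κ₉ α ψ₅ < 1 := by
  unfold κ₉
  rw [Real.sqrt_lt' one_pos]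
  have := mul_pos ha.1 (ha.rate_pos h)
  linarith

/-- The last bound in `κ₀'`, squared, says that the `α²` term under the root is smaller than `ε₅ +
2ε₅²`. -/
lemma κ₁₀_lt_one : S.κ₁₀ α ψ₅ < 1 := by
  unfold κ₁₀
  rw [Real.sqrt_lt' one_pos]
  have h1 : α < S.κ₆' ψ₅ / (√(n : ℝ) * S.dTilde) :=
    EReal.coe_lt_coe_iff.1 (ha.2.1.trans_le ((min_le_right _ _).trans (min_le_right _ _)))
  have hn := h.n_pos
  have hdt := h.dTilde_pos
  have hε := h.ε₅_pos
  have h12 : 0 ≤ 1 - 2 * S.ε₅ := by linarith [h.two_mul_ε₅_le]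
  have hpos : 0 < (1 - 2 * S.ε₅) * S.ψ₃ + S.ψ₄ * ψ₅ :=
    add_pos_of_nonneg_of_pos (mul_nonneg h12 h.ψ₃_pos.le) (mul_pos h.ψ₄_pos (ha.ψ₅_pos h))
  rw [lt_div_iff₀ (by positivity)] at h1
  have h2 := pow_lt_pow_left₀ h1 (mul_nonneg ha.1.le (by positivity)) two_ne_zero
  unfold κ₆' at h2
  rw [Real.sq_sqrt (by positivity), lt_div_iff₀ hpos, mul_pow, mul_pow, Real.sq_sqrt hn.le] at h2
  linarith [(by ring : α ^ 2 * (↑n * S.dTilde ^ 2) * ((1 - 2 * S.ε₅) * S.ψ₃ + S.ψ₄ * ψ₅) =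
    α ^ 2 * ↑n * S.dTilde ^ 2 * ((1 - 2 * S.ε₅) * S.ψ₃ + S.ψ₄ * ψ₅))]

end Admissible

end Setting

end UnifiedCompression

end

/-! ### Lyapunov decrease along one step of the algorithm. -/

noncomputable section

namespace UnifiedCompression

namespace Setting

variable {n d : ℕ} (S : Setting n d)

/-! ### The Lyapunov function -/

/-- The dual variable `E F (v + γ⁻¹ ∇f(1 ⊗ x̄))`. -/
def dualVec (lam : ℝ) (x v : Stack n d) : Stack n d :=
  kron d (centerMat n * S.dualMat lam) (v + S.γ⁻¹ • S.grad (avgStack x))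

/-- The Lyapunov function of the algorithm. -/
def lyapunov (lam : ℝ) (x v : Stack n d) : ℝ :=
  quadLyapunov S.β S.γ (kron d S.L) (kron d (centerMat n) x) (S.dualVec lam x v)
    + n * (S.F (avg x) - S.fStar)

lemma ρ₂_mul_norm_dualVec_le (hn : 2 ≤ n) (hg : S.UndirectedConnected) (lam : ℝ)
    (x v : Stack n d) : S.ρ₂ * ‖S.dualVec lam x v‖ ^ 2 ≤
      inner ℝ (S.dualVec lam x v) (kron d S.L (S.dualVec lam x v)) :=
  S.ρ₂_mul_norm_sq_le hn hg (S.kron_center_kron_center_dual hn lam _)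

/-- The reason for the choice of `dualVec`: through `L` it recovers the centred part of the drift at
the averaged point. -/
lemma mul_kron_L_dualVec (hn : 2 ≤ n) (hg : S.UndirectedConnected) (hS : S.Gains) {lam : ℝ}
    (hlam : 0 < lam) (x v : Stack n d) :
    S.γ • kron d S.L (S.dualVec lam x v) =
      kron d (centerMat n) (S.γ • v + S.grad (avgStack x)) := by
  rw [dualVec, S.kron_L_kron_center_dual hn hg hlam, ← map_smul, smul_add, smul_smul,
    mul_inv_cancel₀ hS.γ_pos.ne', one_smul]

lemma β_add_γ_div (hS : S.Gains) : (S.β + S.γ) / (2 * S.γ) = (1 + S.τ₁) / 2 := by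
  have := hS.γ_pos
  unfold β; field_simp; ring

/-- Young's weight `1 / (2τ₁ρ₂)` on the cross term uses up `τ₁ / 2` of the coefficient `(1 + τ₁) /
2` of `uᵀLu`, and leaves exactly `ε₁` in front of `‖Ex‖²`. -/
lemma le_lyapunov (hn : 2 ≤ n) (hg : S.UndirectedConnected) (hS : S.Gains) (lam : ℝ)
    (x v : Stack n d) :
    S.ε₁ * (‖kron d (centerMat n) x‖ ^ 2 +
      inner ℝ (S.dualVec lam x v) (kron d S.L (S.dualVec lam x v)))
      + n * (S.F (avg x) - S.fStar) ≤ S.lyapunov lam x v := by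
  have hu := S.ρ₂_mul_norm_dualVec_le hn hg lam x v
  have hτ := hS.τ₁_pos
  have hρ := hS.ρ₂_pos
  unfold lyapunov quadLyapunov
  set u := S.dualVec lam x v
  have hW := S.inner_kron_L_nonneg hg u
  have h1 := (abs_le.1 (abs_inner_le_add_sq (kron d (centerMat n) x) u
    (c := 1 / (2 * (S.τ₁ * S.ρ₂))) (by positivity))).1
  have h2 : 1 / (4 * (1 / (2 * (S.τ₁ * S.ρ₂)))) * ‖u‖ ^ 2 = S.τ₁ / 2 * (S.ρ₂ * ‖u‖ ^ 2) := by
    field_simp; norm_num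
  have h3 := mul_le_mul_of_nonneg_left hu (by positivity : 0 ≤ S.τ₁ / 2)
  have h4 := mul_le_mul_of_nonneg_right hS.ε₁_le hW
  rw [h2] at h1
  rw [S.β_add_γ_div hS, mul_add]
  have h5 : S.ε₁ * ‖kron d (centerMat n) x‖ ^ 2 =
      1 / 2 * ‖kron d (centerMat n) x‖ ^ 2
        - 1 / (2 * (S.τ₁ * S.ρ₂)) * ‖kron d (centerMat n) x‖ ^ 2 := by
    rw [hS.ε₁_eq]; ring
  linarith

lemma lyapunov_le (hn : 2 ≤ n) (hg : S.UndirectedConnected) (hopt : S.FiniteOptimum)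
    (hS : S.Gains) (lam : ℝ) (x v : Stack n d) :
    S.lyapunov lam x v ≤ S.ε₂ * (‖kron d (centerMat n) x‖ ^ 2 +
      inner ℝ (S.dualVec lam x v) (kron d S.L (S.dualVec lam x v))
      + n * (S.F (avg x) - S.fStar)) := by
  have hu := S.ρ₂_mul_norm_dualVec_le hn hg lam x v
  have hτ := hS.τ₁_pos
  have hρ := hS.ρ₂_pos
  unfold lyapunov quadLyapunov
  set u := S.dualVec lam x v
  have hW := S.inner_kron_L_nonneg hg u
  have hf : 0 ≤ n * (S.F (avg x) - S.fStar) :=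
    mul_nonneg hS.n_pos.le (sub_nonneg.2 (S.fStar_le hopt _))
  have h1 := (abs_le.1 (abs_inner_le_add_sq (kron d (centerMat n) x) u
    (c := S.τ₁ * S.ρ₂ / 2) (by positivity))).2
  have h2 : 1 / (4 * (S.τ₁ * S.ρ₂ / 2)) * ‖u‖ ^ 2 =
      1 / (2 * S.τ₁ * S.ρ₂ ^ 2) * (S.ρ₂ * ‖u‖ ^ 2) := by
    field_simp; norm_num
  have h3 := mul_le_mul_of_nonneg_left hu (by positivity : 0 ≤ 1 / (2 * S.τ₁ * S.ρ₂ ^ 2))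
  rw [h2] at h1
  rw [S.β_add_γ_div hS, mul_add, mul_add]
  have e1 : (1 + S.τ₁ * S.ρ₂) / 2 ≤ S.ε₂ := le_max_left _ _
  have e2 : (1 + S.τ₁) / 2 + 1 / (2 * S.τ₁ * S.ρ₂ ^ 2) ≤ S.ε₂ := le_max_right _ _
  have h4 := mul_le_mul_of_nonneg_right e1 (sq_nonneg ‖kron d (centerMat n) x‖)
  have h5 := mul_le_mul_of_nonneg_right e2 hW
  have h6 := mul_le_mul_of_nonneg_right hS.one_le_ε₂ hf
  linarith

/-- One step of the algorithm with the compressed point `xh` in place of the exact one. -/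
def nextX (α : ℝ) (x v xh : Stack n d) : Stack n d :=
  x - α • (S.β • kron d S.L xh + S.γ • v + S.grad x)

/-- The corresponding step of the integral variable. -/
def nextV (α : ℝ) (v xh : Stack n d) : Stack n d := v + (α * S.γ) • kron d S.L xh

lemma avg_add_stack (x y : Stack n d) : avg (x + y : Stack n d) = avg x + avg y := by
  simp [avg, Finset.sum_add_distrib, smul_add]

lemma avg_smul_stack (c : ℝ) (x : Stack n d) : avg (c • x : Stack n d) = c • avg x := by
  simp [avg, ← Finset.smul_sum, smul_comm c]

lemma avg_kron_L (hg : S.UndirectedConnected) (i : Fin n) (x : Stack n d) :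
    avg (kron d S.L x) = 0 := by
  rw [← kron_avgMat_apply _ i, ← kron_mul, S.avgMat_mul_L hg, kron_zero]; rfl

lemma avg_nextX (hn : 2 ≤ n) (hg : S.UndirectedConnected) (α : ℝ) (x xh : Stack n d)
    {v : Stack n d} (hv : avg v = 0) :
    avg (S.nextX α x v xh) = avg x - α • avg (S.grad x) := by
  rw [nextX, sub_eq_add_neg, ← neg_smul, avg_add_stack, avg_smul_stack, avg_add_stack,
    avg_add_stack, avg_smul_stack, avg_smul_stack, hv, S.avg_kron_L hg ⟨0, by omega⟩]
  simp [sub_eq_add_neg]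

lemma avg_nextV (hn : 2 ≤ n) (hg : S.UndirectedConnected) (α : ℝ) (xh : Stack n d)
    {v : Stack n d} (hv : avg v = 0) : avg (S.nextV α v xh) = 0 := by
  rw [nextV, avg_add_stack, avg_smul_stack, hv, S.avg_kron_L hg ⟨0, by omega⟩]
  simp

/-- The change of the dual variable caused by the change of the averaged point. -/
def dualShift (lam : ℝ) (x x' : Stack n d) : Stack n d :=
  kron d (centerMat n * S.dualMat lam) (S.grad (avgStack x') - S.grad (avgStack x))

/-- Neither `L` nor the mean-zero `v` moves the average, so `x̄` changes by `-α` times the averaged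
gradient, and the drift is of order `α`. -/
lemma norm_kron_L_dualShift_le (hn : 2 ≤ n) (hg : S.UndirectedConnected) (hs : S.Smooth)
    {lam : ℝ} (hlam : 0 < lam) {α : ℝ} {x v : Stack n d} (xh : Stack n d) (hv : avg v = 0) :
    ‖kron d S.L (S.dualShift lam x (S.nextX α x v xh))‖ ^ 2 ≤
      S.ℓ ^ 2 * α ^ 2 * (n * ‖avg (S.grad x)‖ ^ 2) := by
  rw [dualShift, S.kron_L_kron_center_dual hn hg hlam]
  refine (norm_center_le (by omega) _).trans ((S.norm_grad_sub_sq_le hs _ _).trans (le_of_eq ?_))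
  have h1 : avgStack (S.nextX α x v xh) - avgStack x =
      stack fun _ : Fin n => -(α • avg (S.grad x)) := by
    ext i a
    simp [avgStack, S.avg_nextX hn hg α x xh hv]
  rw [h1, norm_stack_const_sq, norm_neg, norm_smul, mul_pow, Real.norm_eq_abs, sq_abs]
  ring

/-- With the gradient at the average absorbed in `u`, only a gradient difference of size at most `ℓ
‖Ex‖` remains. -/
lemma center_nextX (hn : 2 ≤ n) (hg : S.UndirectedConnected) (hS : S.Gains) {lam : ℝ}
    (hlam : 0 < lam) (α : ℝ) (x v xh : Stack n d) :
    kron d (centerMat n) (S.nextX α x v xh) = kron d (centerMat n) x -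
      α • (S.β • kron d S.L (kron d (centerMat n) x - kron d (centerMat n) (x - xh))
        + S.γ • kron d S.L (S.dualVec lam x v)
        + kron d (centerMat n) (S.grad x - S.grad (avgStack x))) := by
  have h1 : kron d S.L (kron d (centerMat n) x - kron d (centerMat n) (x - xh)) =
      kron d S.L xh := by
    rw [← map_sub, sub_sub_cancel, ← kron_mul, S.L_mul_centerMat]
  have h2 : kron d (centerMat n) (kron d S.L xh) = kron d S.L xh := by
    rw [← kron_mul, S.centerMat_mul_L hg]
  rw [h1, S.mul_kron_L_dualVec hn hg hS hlam, nextX]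
  simp only [map_sub, map_add, map_smul, h2]
  congr 2
  abel

lemma dualVec_next (hn : 2 ≤ n) (hg : S.UndirectedConnected) {lam : ℝ}
    (hlam : 0 < lam) (α : ℝ) (x v xh : Stack n d) :
    S.dualVec lam (S.nextX α x v xh) (S.nextV α v xh) = S.dualVec lam x v
      + (α * S.γ) • (kron d (centerMat n) x - kron d (centerMat n) (x - xh))
      + S.γ⁻¹ • S.dualShift lam x (S.nextX α x v xh) := by
  have h1 : kron d (centerMat n) x - kron d (centerMat n) (x - xh) =
      kron d (centerMat n) xh := by
    rw [← map_sub, sub_sub_cancel]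
  rw [h1, dualVec, dualVec, dualShift, nextV]
  simp only [map_sub, map_add, map_smul, S.kron_center_dual_kron_L hn hg hlam, smul_sub]
  abel

/-- Decrease of the Lyapunov function along a step with compression error `x - xh`. -/
lemma lyapunov_step_le (hn : 2 ≤ n) (hg : S.UndirectedConnected) (hs : S.Smooth)
    (hopt : S.FiniteOptimum) (hPL : S.PolyakLojasiewicz) (hS : S.Gains) {α ψ₅ : ℝ}
    (ha : S.Admissible α ψ₅) {lam : ℝ} (hlam : 0 < lam) {x v : Stack n d} (xh : Stack n d)
    (hv : avg v = 0) :
    S.lyapunov lam (S.nextX α x v xh) (S.nextV α v xh) ≤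
      (1 - α * S.ε₆ α) * S.lyapunov lam x v + α * S.ψ₂ α * ‖x - xh‖ ^ 2 := by
  have hn0 : n ≠ 0 := by omega
  have hα := ha.1
  have hcc : ∀ y : Stack n d, S.ρ₂ * ‖kron d (centerMat n) y‖ ^ 2 ≤
      inner ℝ (kron d (centerMat n) y) (kron d S.L (kron d (centerMat n) y)) := fun y =>
    S.ρ₂_mul_norm_sq_le hn hg (kron_centerMat_idem hn0 y)
  have hh : ‖kron d (centerMat n) (S.grad x - S.grad (avgStack x))‖ ^ 2 ≤
      S.ℓ ^ 2 * ‖kron d (centerMat n) x‖ ^ 2 := by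
    refine (norm_center_le hn0 _).trans ?_
    rw [← sub_avgStack]
    exact S.norm_grad_sub_sq_le hs _ _
  have hr : S.ρ₂ * ‖S.dualShift lam x (S.nextX α x v xh)‖ ^ 2 ≤
      inner ℝ (S.dualShift lam x (S.nextX α x v xh))
        (kron d S.L (S.dualShift lam x (S.nextX α x v xh))) :=
    S.ρ₂_mul_norm_sq_le hn hg (S.kron_center_kron_center_dual hn lam _)
  have hz := hcc xh
  rw [show kron d (centerMat n) xh =
    kron d (centerMat n) x - kron d (centerMat n) (x - xh) by rw [← map_sub, sub_sub_cancel]] at hz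
  have K1 := quadLyapunov_step_le (ℓ := S.ℓ) hS.β_pos hS.γ_pos hα hS.ρ₂_pos hS.four_mul_γ_le
    hS.ρ₂_le_ρ (S.inner_kron_L_symm hg) (S.inner_kron_L_nonneg hg) (S.norm_kron_L_sq_le hg)
    (hcc x) hz (S.ρ₂_mul_norm_dualVec_le hn hg lam x v) hr hh
    (S.norm_kron_L_dualShift_le hn hg hs hlam xh hv)
  rw [← S.center_nextX hn hg hS hlam, ← S.dualVec_next hn hg hlam] at K1
  have K2 := S.F_step_le hn0 hs hα x
  rw [← S.avg_nextX hn hg α x xh hv] at K2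
  have K3 := hPL.bound (avg x)
  have K4 := S.lyapunov_le hn hg hopt hS lam x v
  have K5 := norm_center_le hn0 (x - xh)
  have hf : 0 ≤ n * (S.F (avg x) - S.fStar) :=
    mul_nonneg hS.n_pos.le (sub_nonneg.2 (S.fStar_le hopt _))
  have hW := S.inner_kron_L_nonneg hg (S.dualVec lam x v)
  obtain ⟨-, -, hφ⟩ := ha.mul_lt hS
  have hε2 : 0 < S.ε₂ := by linarith [hS.one_le_ε₂]
  have hmV : α * S.ε₆ α * S.lyapunov lam x v ≤ α * min (S.ν / 2) (S.ε₃ α) *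
      (‖kron d (centerMat n) x‖ ^ 2 +
        inner ℝ (S.dualVec lam x v) (kron d S.L (S.dualVec lam x v))
        + n * (S.F (avg x) - S.fStar)) := by
    have h1 := mul_le_mul_of_nonneg_left K4 (mul_pos hα (ha.ε₆_pos hS)).le
    refine h1.trans (le_of_eq ?_)
    unfold ε₆
    field_simp
  have hψ := mul_le_mul_of_nonneg_left K5 (mul_pos hα (hS.ψ₂_pos hα)).le
  unfold lyapunov at hmV ⊢
  set Q' := quadLyapunov S.β S.γ (kron d S.L) (kron d (centerMat n) (S.nextX α x v xh))
    (S.dualVec lam (S.nextX α x v xh) (S.nextV α v xh))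
  set Q := quadLyapunov S.β S.γ (kron d S.L) (kron d (centerMat n) x) (S.dualVec lam x v)
  set X := ‖kron d (centerMat n) x‖ ^ 2
  set W := inner ℝ (S.dualVec lam x v) (kron d S.L (S.dualVec lam x v))
  set G := (n : ℝ) * ‖avg (S.grad x)‖ ^ 2
  have hX : 0 ≤ X := sq_nonneg _
  have hG : 0 ≤ G := mul_nonneg hS.n_pos.le (sq_nonneg _)
  have m1 : α * min (S.ν / 2) (S.ε₃ α) * X ≤ α * (S.φ₁ - α * S.φ₂) * X := by
    gcongr
    exact (min_le_right _ _).trans (min_le_left _ _)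
  have m2 : α * min (S.ν / 2) (S.ε₃ α) * W ≤ α * (S.φ₃ - α * S.φ₄) * W := by
    gcongr
    exact (min_le_right _ _).trans (min_le_right _ _)
  have m3 : α * min (S.ν / 2) (S.ε₃ α) * (n * (S.F (avg x) - S.fStar)) ≤
      α * S.ν * (n * (S.F (avg x) - S.fStar)) := by
    gcongr
    exact (min_le_left _ _).trans (by linarith [hS.ν_pos])
  have m4 : α * S.ν * (n * (S.F (avg x) - S.fStar)) ≤
      α / 2 * (n * ‖gradient S.F (avg x)‖ ^ 2) := by
    have := mul_le_mul_of_nonneg_left K3 (mul_nonneg hα.le hS.n_pos.le)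
    linarith
  -- Descent supplies `1 / 2` of `G`; `φ₅` budgets `1 / 8` of it against the dual drift, and `m6`
  -- discards the other `3 / 8`.
  have m5 : 0 ≤ α * (S.φ₅ - α * S.φ₆) * G :=
    mul_nonneg (mul_nonneg hα.le (by linarith)) hG
  have m6 : 0 ≤ α * (3 / 8) * G := by positivity
  unfold ψ₂ φ₇ φ₈ at hψ ⊢
  unfold φ₁ φ₂ at m1
  unfold φ₃ φ₄ at m2
  unfold φ₅ φ₆ at m5
  linarith

end Setting

end UnifiedCompression

end

/-! ### Step length, compression error and the induction on the scale. -/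

noncomputable section

namespace UnifiedCompression

lemma norm_add_four_sq_le {H : Type*} [NormedAddCommGroup H] (a b c e : H) :
    ‖a + b + c + e‖ ^ 2 ≤ 4 * (‖a‖ ^ 2 + ‖b‖ ^ 2 + ‖c‖ ^ 2 + ‖e‖ ^ 2) := by
  have h1 : ‖a + b + c + e‖ ≤ ‖a‖ + ‖b‖ + ‖c‖ + ‖e‖ :=
    (norm_add_le _ _).trans (by gcongr; exact norm_add₃_le)
  have h2 := pow_le_pow_left₀ (norm_nonneg _) h1 2
  nlinarith [sq_nonneg (‖a‖ - ‖b‖), sq_nonneg (‖a‖ - ‖c‖), sq_nonneg (‖a‖ - ‖e‖),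
    sq_nonneg (‖b‖ - ‖c‖), sq_nonneg (‖b‖ - ‖e‖), sq_nonneg (‖c‖ - ‖e‖)]

namespace Setting

variable {n d : ℕ} (S : Setting n d)

lemma norm_kron_L_sq_le' (hg : S.UndirectedConnected) (hS : S.Gains) (x : Stack n d) :
    ‖kron d S.L x‖ ^ 2 ≤ S.ρ ^ 2 * ‖x‖ ^ 2 := by
  have h1 := S.norm_kron_L_sq_le hg x
  have h2 := mul_le_mul_of_nonneg_left
    (inner_le_of_norm_sq_le (S.norm_kron_L_sq_le hg) hS.ρ_pos x) hS.ρ_pos.le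
  linarith [(by ring : S.ρ * (S.ρ * ‖x‖ ^ 2) = S.ρ ^ 2 * ‖x‖ ^ 2)]

/-- The length of a step in terms of the compression error and the Lyapunov function. -/
lemma norm_nextX_sub_sq_le (hn : 2 ≤ n) (hg : S.UndirectedConnected) (hs : S.Smooth)
    (hopt : S.FiniteOptimum) (hS : S.Gains) (α : ℝ) {lam : ℝ} (hlam : 0 < lam)
    {x v : Stack n d} (xh : Stack n d) (hv : avg v = 0) :
    ‖S.nextX α x v xh - x‖ ^ 2 ≤ 4 * α ^ 2 * (S.β ^ 2 * S.ρ ^ 2 * ‖x - xh‖ ^ 2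
      + max (S.β ^ 2 * S.ρ ^ 2 + S.ℓ ^ 2) (S.γ ^ 2 * S.ρ) / S.ε₁ * S.lyapunov lam x v) := by
  have hn0 : n ≠ 0 := by omega
  set M := max (S.β ^ 2 * S.ρ ^ 2 + S.ℓ ^ 2) (S.γ ^ 2 * S.ρ) with hM
  set g₀ := S.γ • v + S.grad (avgStack x) with hg₀
  have hx1 : kron d S.L x = kron d S.L (kron d (centerMat n) x) := by
    rw [← kron_mul, S.L_mul_centerMat]
  -- `g₀` has centred part `γ L u` and average `∇F(x̄)`, so each of the four pieces is controlled by
  -- `e` or by a term of the Lyapunov function.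
  have hdec : S.nextX α x v xh - x = (-α) • (S.β • kron d S.L (kron d (centerMat n) x)
      + (-S.β) • kron d S.L (x - xh) + g₀ + (S.grad x - S.grad (avgStack x))) := by
    rw [nextX, ← hx1, hg₀, map_sub]
    module
  have hβ : ∀ y : Stack n d, ‖kron d S.L y‖ ^ 2 ≤ S.ρ ^ 2 * ‖y‖ ^ 2 := S.norm_kron_L_sq_le' hg hS
  have n1 : ‖S.β • kron d S.L (kron d (centerMat n) x)‖ ^ 2 ≤
      S.β ^ 2 * (S.ρ ^ 2 * ‖kron d (centerMat n) x‖ ^ 2) := by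
    rw [norm_smul, mul_pow, Real.norm_eq_abs, sq_abs]
    have := hβ (kron d (centerMat n) x)
    gcongr
  have n2 : ‖(-S.β) • kron d S.L (x - xh)‖ ^ 2 ≤ S.β ^ 2 * (S.ρ ^ 2 * ‖x - xh‖ ^ 2) := by
    rw [norm_smul, mul_pow, Real.norm_eq_abs, sq_abs, neg_sq]
    have := hβ (x - xh)
    gcongr
  have n3 : ‖g₀‖ ^ 2 ≤ S.γ ^ 2 * (S.ρ * inner ℝ (S.dualVec lam x v)
      (kron d S.L (S.dualVec lam x v))) + 2 * S.ℓ * (n * (S.F (avg x) - S.fStar)) := by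
    have h1 : avg g₀ = gradient S.F (avg x) := by
      rw [hg₀, avg_add_stack, avg_smul_stack, hv, smul_zero, zero_add, S.gradient_F hs]
      rfl
    rw [norm_sq_eq_center_add hn0 g₀, hg₀, ← S.mul_kron_L_dualVec hn hg hS hlam, ← hg₀, h1,
      norm_smul, mul_pow, Real.norm_eq_abs, sq_abs]
    have h2 := mul_le_mul_of_nonneg_left (norm_gradient_sq_le hS.ℓ_pos (S.differentiable_F hs)
      (S.gradient_F_lipschitz hn0 hs) (S.fStar_le hopt) (avg x)) hS.n_pos.le
    have h3 := mul_le_mul_of_nonneg_left (S.norm_kron_L_sq_le hg (S.dualVec lam x v))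
      (sq_nonneg S.γ)
    linarith
  have n4 : ‖S.grad x - S.grad (avgStack x)‖ ^ 2 ≤ S.ℓ ^ 2 * ‖kron d (centerMat n) x‖ ^ 2 := by
    rw [← sub_avgStack]; exact S.norm_grad_sub_sq_le hs _ _
  have hV := S.le_lyapunov hn hg hS lam x v
  have hf : 0 ≤ n * (S.F (avg x) - S.fStar) :=
    mul_nonneg hS.n_pos.le (sub_nonneg.2 (S.fStar_le hopt _))
  have hW := S.inner_kron_L_nonneg hg (S.dualVec lam x v)
  set X := ‖kron d (centerMat n) x‖ ^ 2
  set W := inner ℝ (S.dualVec lam x v) (kron d S.L (S.dualVec lam x v))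
  have hX : 0 ≤ X := sq_nonneg _
  have hε := hS.ε₁_pos
  have hM0 : 0 < M := lt_max_of_lt_right (by have := hS.ρ_pos; have := hS.γ_pos; positivity)
  have m1 : (S.β ^ 2 * S.ρ ^ 2 + S.ℓ ^ 2) * X ≤ M * X := by gcongr; exact le_max_left _ _
  have m2 : S.γ ^ 2 * S.ρ * W ≤ M * W := by gcongr; exact le_max_right _ _
  have m3 : 2 * S.ℓ * (n * (S.F (avg x) - S.fStar)) ≤ M * (n * (S.F (avg x) - S.fStar)) := by
    gcongr
    refine le_trans ?_ (le_max_left _ _)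
    -- With `βρ ≥ 1`, `2ℓ ≤ 2βρℓ ≤ β²ρ² + ℓ²`, so the cost term fits under the same maximum.
    have h1 : 1 ≤ S.β * S.ρ := by linarith [hS.four_mul_γ_le', hS.two_lt_γ]
    nlinarith [sq_nonneg (S.β * S.ρ - S.ℓ), mul_le_mul_of_nonneg_right h1 hS.ℓ_pos.le]
  have m4 : M * (X + W + n * (S.F (avg x) - S.fStar)) ≤ M / S.ε₁ * S.lyapunov lam x v := by
    rw [div_mul_eq_mul_div, le_div_iff₀ hε, mul_assoc]
    gcongr
    refine le_trans ?_ hV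
    have := mul_le_mul_of_nonneg_right hS.ε₁_le hf
    linarith
  rw [hdec, norm_smul, mul_pow, Real.norm_eq_abs, sq_abs, neg_sq]
  have h4 := norm_add_four_sq_le (S.β • kron d S.L (kron d (centerMat n) x))
    ((-S.β) • kron d S.L (x - xh)) g₀ (S.grad x - S.grad (avgStack x))
  rw [mul_comm 4, mul_assoc]
  gcongr
  linarith

/-- The compressor shrinks the error inside the local region. -/
lemma lpNorm_compress_sq_le (hc : S.LocallyBounded) (hω : 0 < S.ω) (hω' : S.ω ≤ 1 / S.r)
    {s : ℝ} (hs : 0 < s) {z : Vec d} (hz : lpNorm S.p z ≤ S.C * s) :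
    lpNorm S.p (z - (S.ω * s) • S.comp (s⁻¹ • z)) ^ 2 ≤ (1 - 2 * S.ε₅) * (S.C ^ 2 * s ^ 2) := by
  have hp := hc.one_le_p
  have hr := hc.r_pos
  have hC := hc.C_pos
  set θ := S.ω * S.r with hθ
  have hθ0 : 0 ≤ θ := (mul_pos hω hr).le
  have hθ1 : θ ≤ 1 := by rwa [le_div_iff₀ hr] at hω'
  have hu : lpNorm S.p (s⁻¹ • z) ≤ S.C := by
    rw [lpNorm_smul hp, abs_of_pos (inv_pos.2 hs), inv_mul_le_iff₀ hs]; linarith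
  have hb := hc.bound _ hu
  -- The relaxation `θ = ωr ≤ 1` mixes the scaled point, of norm at most `C`, with its compression
  -- residual, of norm at most `C (1 - δ)`; the total is at most `C (1 - θδ)`.
  have hdec : z - (S.ω * s) • S.comp (s⁻¹ • z) =
      s • ((1 - θ) • (s⁻¹ • z) + (-θ) • (S.r⁻¹ • S.comp (s⁻¹ • z) - s⁻¹ • z)) := by
    have h1 : s • s⁻¹ • z = z := by rw [smul_smul, mul_inv_cancel₀ hs.ne', one_smul]
    have h2 : θ • S.r⁻¹ • S.comp (s⁻¹ • z) = S.ω • S.comp (s⁻¹ • z) := by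
      rw [smul_smul, hθ, mul_assoc, mul_inv_cancel₀ hr.ne', mul_one]
    have h3 : (1 - θ) • (s⁻¹ • z) + (-θ) • (S.r⁻¹ • S.comp (s⁻¹ • z) - s⁻¹ • z) =
        s⁻¹ • z - θ • S.r⁻¹ • S.comp (s⁻¹ • z) := by module
    rw [h3, h2, smul_sub, h1, smul_smul, mul_comm S.ω]
  have hle : lpNorm S.p ((1 - θ) • (s⁻¹ • z) + (-θ) • (S.r⁻¹ • S.comp (s⁻¹ • z) - s⁻¹ • z)) ≤
      S.C * (1 - θ * S.δ) := by
    refine (lpNorm_add_le hp _ _).trans ?_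
    rw [lpNorm_smul hp (1 - θ), lpNorm_smul hp (-θ), abs_neg, abs_of_nonneg hθ0,
      abs_of_nonneg (sub_nonneg.2 hθ1)]
    have h1 := mul_le_mul_of_nonneg_left hu (sub_nonneg.2 hθ1)
    have h2 := mul_le_mul_of_nonneg_left hb hθ0
    linarith
  have hsq := pow_le_pow_left₀ (lpNorm_nonneg hp _) hle 2
  rw [hdec, lpNorm_smul hp, mul_pow, sq_abs]
  -- The difference of the two sides is `θ (1 - θ) δ²`.
  have h5 : (1 - θ * S.δ) ^ 2 ≤ 1 - 2 * S.ε₅ := by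
    unfold ε₅
    rw [← hθ]
    nlinarith [mul_nonneg (mul_nonneg hθ0 (sub_nonneg.2 hθ1)) (sq_nonneg S.δ)]
  calc s ^ 2 * _ ≤ s ^ 2 * (S.C * (1 - θ * S.δ)) ^ 2 := by gcongr
    _ = (1 - θ * S.δ) ^ 2 * (S.C ^ 2 * s ^ 2) := by ring
    _ ≤ _ := by gcongr

/-! ### The iteration -/

/-- The invariant of the iteration at scale `s`. -/
structure Invariant (ψ₅ lam s : ℝ) (z : State n d) : Prop where
  y_eq : stack z.y = kron d S.L (stack z.xhat)
  avg_v : avg z.v = 0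
  lyapunov_le : S.lyapunov lam (stack z.x) (stack z.v) ≤
    n * S.dTilde ^ 2 * ψ₅ * S.C ^ 2 * s ^ 2
  lpNorm_le : ∀ i, lpNorm S.p (z.x i - z.xhat i) ≤ S.C * s

variable {S}

lemma stack_step_y {ψ₅ lam s : ℝ} {z : State n d} (hz : S.Invariant ψ₅ lam s z) (α s' : ℝ) :
    stack (S.step α s' z).y = kron d S.L (stack (S.step α s' z).xhat) := by
  have h1 : stack (S.step α s' z).xhat = stack z.xhat +
      (S.ω * s') • stack (fun i => S.comp (s'⁻¹ • (z.x i - z.xhat i))) := rfl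
  rw [h1, map_add, map_smul, ← hz.y_eq]
  rfl

/-- The point update uses the new `y`, so the compressed point entering `nextX` is the new `xhat`,
while the invariant measures `x` against the old one. -/
lemma stack_step_x {ψ₅ lam s : ℝ} {z : State n d} (hz : S.Invariant ψ₅ lam s z) (α s' : ℝ) :
    stack (S.step α s' z).x =
      S.nextX α (stack z.x) (stack z.v) (stack (S.step α s' z).xhat) := by
  rw [nextX, ← stack_step_y hz]
  rfl

lemma stack_step_v {ψ₅ lam s : ℝ} {z : State n d} (hz : S.Invariant ψ₅ lam s z) (α s' : ℝ) :
    stack (S.step α s' z).v = S.nextV α (stack z.v) (stack (S.step α s' z).xhat) := by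
  rw [nextV, ← stack_step_y hz]
  rfl

lemma Invariant.step (hn : 2 ≤ n) (hc : S.LocallyBounded) (hg : S.UndirectedConnected)
    (hs : S.Smooth) (hopt : S.FiniteOptimum) (hPL : S.PolyakLojasiewicz) (hS : S.Gains)
    (hω : 0 < S.ω) (hω' : S.ω ≤ 1 / S.r) {α ψ₅ : ℝ} (ha : S.Admissible α ψ₅) {lam : ℝ}
    (hlam : 0 < lam) {ε s : ℝ} (hε9 : S.κ₉ α ψ₅ < ε) (hε10 : S.κ₁₀ α ψ₅ < ε) (hs0 : 0 < s)
    {z : State n d} (hz : S.Invariant ψ₅ lam s z) :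
    S.Invariant ψ₅ lam (s * ε) (S.step α s z) := by
  have hε0 : 0 < ε := (Real.sqrt_nonneg _).trans_lt hε9
  have hp := hc.one_le_p
  have hψ := ha.ψ₅_pos hS
  have hα := ha.1
  have h12 : 0 ≤ 1 - 2 * S.ε₅ := by linarith [hS.two_mul_ε₅_le]
  have hε5 := hS.ε₅_pos
  have hC := hc.C_pos
  have hx := stack_step_x hz α s
  have hv := stack_step_v hz α s
  set z' := S.step α s z
  have herr : ∀ i, lpNorm S.p (z.x i - z'.xhat i) ^ 2 ≤ (1 - 2 * S.ε₅) * (S.C ^ 2 * s ^ 2) := by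
    intro i
    have h1 := S.lpNorm_compress_sq_le hc hω hω' hs0 (hz.lpNorm_le i)
    rwa [sub_sub] at h1
  have he : ‖stack z.x - stack z'.xhat‖ ^ 2 ≤
      n * S.dTilde ^ 2 * (1 - 2 * S.ε₅) * (S.C ^ 2 * s ^ 2) := by
    rw [PiLp.norm_sq_eq_of_L2]
    calc ∑ i, ‖(stack z.x - stack z'.xhat) i‖ ^ 2
        ≤ ∑ _i : Fin n, S.dTilde ^ 2 * ((1 - 2 * S.ε₅) * (S.C ^ 2 * s ^ 2)) := by
          refine Finset.sum_le_sum fun i _ => ?_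
          have h1 := pow_le_pow_left₀ (norm_nonneg _)
            (S.norm_le_dTilde_mul hp (z.x i - z'.xhat i)) 2
          rw [mul_pow] at h1
          exact h1.trans (mul_le_mul_of_nonneg_left (herr i) (sq_nonneg _))
      _ = _ := by
          rw [Finset.sum_const, Finset.card_univ, Fintype.card_fin, nsmul_eq_mul]; ring
  refine ⟨stack_step_y hz α s, ?_, ?_, fun i => ?_⟩
  · have := S.avg_nextV hn hg α (stack z'.xhat) (v := stack z.v) hz.avg_v
    rwa [← hv] at this
  · have h1 := S.lyapunov_step_le hn hg hs hopt hPL hS ha hlam (x := stack z.x)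
      (stack z'.xhat) (v := stack z.v) hz.avg_v
    rw [← hx, ← hv] at h1
    have h2 := mul_le_mul_of_nonneg_left hz.lyapunov_le
      (sub_nonneg.2 (ha.mul_ε₆_le_one hS))
    have h3 := mul_le_mul_of_nonneg_left he (mul_pos hα (hS.ψ₂_pos hα)).le
    -- The left side is the quantity under the root in `κ₉`; `h6` recognizes it as contraction plus
    -- injected error, relative to the current bound on `V`.
    have h4 : 1 - α * (S.ε₆ α - (1 - 2 * S.ε₅) * S.ψ₂ α * (1 / ψ₅)) ≤ ε ^ 2 :=
      ((Real.sqrt_lt' hε0).1 hε9).le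
    have h5 := mul_le_mul_of_nonneg_left h4
      (by have := hS.n_pos; positivity : 0 ≤ n * S.dTilde ^ 2 * ψ₅ * S.C ^ 2 * s ^ 2)
    have h6 : n * S.dTilde ^ 2 * ψ₅ * S.C ^ 2 * s ^ 2 *
        (1 - α * (S.ε₆ α - (1 - 2 * S.ε₅) * S.ψ₂ α * (1 / ψ₅))) =
        (1 - α * S.ε₆ α) * (n * S.dTilde ^ 2 * ψ₅ * S.C ^ 2 * s ^ 2) +
        α * S.ψ₂ α * (n * S.dTilde ^ 2 * (1 - 2 * S.ε₅) * (S.C ^ 2 * s ^ 2)) := by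
      field_simp; ring
    rw [mul_pow]
    linarith
  -- `x_{k+1} - x̂_k` is the compression error `x_k - x̂_k` plus the step `x_{k+1} - x_k`.
  · refine abs_le_of_sq_le_sq' ?_ (by positivity) |>.2
    have h1 := S.norm_nextX_sub_sq_le hn hg hs hopt hS α hlam (x := stack z.x)
      (stack z'.xhat) (v := stack z.v) hz.avg_v
    rw [← hx] at h1
    set M := max (S.β ^ 2 * S.ρ ^ 2 + S.ℓ ^ 2) (S.γ ^ 2 * S.ρ) with hM
    have hM0 : 0 ≤ M := le_max_of_le_right (by have := hS.ρ_pos; positivity)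
    have hε1 := hS.ε₁_pos
    set T := S.C ^ 2 * s ^ 2 with hT
    have h2 : ‖stack z'.x - stack z.x‖ ^ 2 ≤ 4 * α ^ 2 * (S.β ^ 2 * S.ρ ^ 2 *
        (n * S.dTilde ^ 2 * (1 - 2 * S.ε₅) * T)
        + M / S.ε₁ * (n * S.dTilde ^ 2 * ψ₅ * S.C ^ 2 * s ^ 2)) := by
      refine h1.trans ?_
      have := hz.lyapunov_le
      gcongr
    have h3 : lpNorm S.p (z'.x i - z.x i) ^ 2 ≤
        S.dHat ^ 2 * ‖stack z'.x - stack z.x‖ ^ 2 := by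
      have k1 := pow_le_pow_left₀ (lpNorm_nonneg hp _)
        (S.lpNorm_le_dHat_mul hp (z'.x i - z.x i)) 2
      rw [mul_pow] at k1
      refine k1.trans ?_
      have k2 := PiLp.norm_apply_le (stack z'.x - stack z.x) i
      have k3 : (stack z'.x - stack z.x) i = z'.x i - z.x i := rfl
      rw [k3] at k2
      gcongr
    have h4 : lpNorm S.p (z'.x i - z'.xhat i) ≤
        lpNorm S.p (z.x i - z'.xhat i) + lpNorm S.p (z'.x i - z.x i) := by
      have := lpNorm_add_le hp (z.x i - z'.xhat i) (z'.x i - z.x i)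
      rwa [show z.x i - z'.xhat i + (z'.x i - z.x i) = z'.x i - z'.xhat i by abel] at this
    have h5 := pow_le_pow_left₀ (lpNorm_nonneg hp _) h4 2
    -- Young's weight `ε₅` inflates the compressed error only to `(1 + ε₅)(1 - 2ε₅) = 1 - ε₅ -
    -- 2ε₅²`; the factor `1 + ε₅⁻¹` on the step is part of `ψ₃` and `ψ₄`.
    have h6 : ∀ a b : ℝ, (a + b) ^ 2 ≤ (1 + S.ε₅) * a ^ 2 + (1 + S.ε₅⁻¹) * b ^ 2 := by
      intro a b
      have k1 : 0 ≤ S.ε₅⁻¹ * (S.ε₅ * a - b) ^ 2 := by positivity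
      have k2 : S.ε₅⁻¹ * (S.ε₅ * a - b) ^ 2 = S.ε₅ * a ^ 2 + S.ε₅⁻¹ * b ^ 2 - 2 * a * b := by
        field_simp; ring
      linarith
    have h7 : 1 - (S.ε₅ + 2 * S.ε₅ ^ 2)
        + α ^ 2 * n * S.dTilde ^ 2 * ((1 - 2 * S.ε₅) * S.ψ₃ + S.ψ₄ * ψ₅) ≤ ε ^ 2 :=
      ((Real.sqrt_lt' hε0).1 hε10).le
    have h8 := mul_le_mul_of_nonneg_left h7 (by positivity : 0 ≤ T)
    have h9 : (1 + S.ε₅) * ((1 - 2 * S.ε₅) * T) + (1 + S.ε₅⁻¹) * (S.dHat ^ 2 *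
        (4 * α ^ 2 * (S.β ^ 2 * S.ρ ^ 2 * (n * S.dTilde ^ 2 * (1 - 2 * S.ε₅) * T)
        + M / S.ε₁ * (n * S.dTilde ^ 2 * ψ₅ * S.C ^ 2 * s ^ 2)))) =
        T * (1 - (S.ε₅ + 2 * S.ε₅ ^ 2)
        + α ^ 2 * n * S.dTilde ^ 2 * ((1 - 2 * S.ε₅) * S.ψ₃ + S.ψ₄ * ψ₅)) := by
      unfold ψ₃ ψ₄
      rw [← hM, hT]
      ring
    calc lpNorm S.p (z'.x i - z'.xhat i) ^ 2
        ≤ (lpNorm S.p (z.x i - z'.xhat i) + lpNorm S.p (z'.x i - z.x i)) ^ 2 := h5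
      _ ≤ (1 + S.ε₅) * lpNorm S.p (z.x i - z'.xhat i) ^ 2
          + (1 + S.ε₅⁻¹) * lpNorm S.p (z'.x i - z.x i) ^ 2 := h6 _ _
      _ ≤ (1 + S.ε₅) * ((1 - 2 * S.ε₅) * T) + (1 + S.ε₅⁻¹) * (S.dHat ^ 2 *
        (4 * α ^ 2 * (S.β ^ 2 * S.ρ ^ 2 * (n * S.dTilde ^ 2 * (1 - 2 * S.ε₅) * T)
        + M / S.ε₁ * (n * S.dTilde ^ 2 * ψ₅ * S.C ^ 2 * s ^ 2)))) := by
          have k1 := herr i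
          have k2 := h3.trans (mul_le_mul_of_nonneg_left h2 (sq_nonneg _))
          gcongr
      _ ≤ (S.C * (s * ε)) ^ 2 := by
          rw [h9]
          refine h8.trans (le_of_eq ?_)
          rw [hT]; ring

/-- The initial Lyapunov value is at most the computable bound `κν`. -/
lemma lyapunov_init_le (hn : 2 ≤ n) (hg : S.UndirectedConnected) (hPL : S.PolyakLojasiewicz)
    (hS : S.Gains) {lam : ℝ} (hlam : 0 < lam) (x₀ : Fin n → Vec d) :
    S.lyapunov lam (stack x₀) (stack 0) ≤ S.κν lam x₀ := by
  have hn0 : n ≠ 0 := by omega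
  have hν := hPL.ν_pos
  have hγ := hS.γ_pos
  have hβ := hS.β_pos
  set w : Stack n d := stack fun i => S.γ⁻¹ • gradient (S.f i) (avg x₀)
  have hu : S.dualVec lam (stack x₀) (stack 0) = kron d (centerMat n * S.dualMat lam) w := by
    rw [dualVec, show (stack 0 : Stack n d) = 0 from rfl, zero_add]
    rfl
  have h1 : stackedForm (centerMat n) x₀ x₀ = ‖kron d (centerMat n) (stack x₀)‖ ^ 2 := by
    have := inner_kron (centerMat n) (stack x₀) (stack x₀)
    rw [← this, ← real_inner_self_eq_norm_sq, ← inner_kron_centerMat, kron_centerMat_idem hn0]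
  have h2 : stackedForm (centerMat n * S.dualMat lam) x₀ w =
      inner ℝ (kron d (centerMat n) (stack x₀)) (kron d (centerMat n * S.dualMat lam) w) := by
    have := inner_kron (centerMat n * S.dualMat lam) (stack x₀) w
    rw [← this, ← inner_kron_centerMat, S.kron_center_kron_center_dual hn]
  have h3 := S.inner_kron_center_dual_le hn hg hlam w
  have h4 := hPL.bound (avg x₀)
  have h5 : n * (S.F (avg x₀) - S.fStar) ≤
      1 / (2 * S.ν) * (n * ‖gradient S.F (avg x₀)‖ ^ 2) := by
    have k := mul_le_mul_of_nonneg_left h4 (by have := hS.n_pos; positivity : 0 ≤ (n : ℝ) / S.ν)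
    have e1 : (n : ℝ) / S.ν * (S.ν * (S.F (avg x₀) - S.fStar)) =
      n * (S.F (avg x₀) - S.fStar) := by field_simp
    have e2 : (n : ℝ) / S.ν * (1 / 2 * ‖gradient S.F (avg x₀)‖ ^ 2) =
      1 / (2 * S.ν) * (n * ‖gradient S.F (avg x₀)‖ ^ 2) := by field_simp
    linarith
  have h6 := mul_le_mul_of_nonneg_left h3 (by positivity : 0 ≤ (S.β + S.γ) / (2 * S.γ))
  have h7 : (S.β + S.γ) / (2 * S.γ) * stackedForm (S.dualMat lam) w w =
      1 / 2 * ((S.β + S.γ) / S.γ * stackedForm (S.dualMat lam) w w) := by field_simp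
  rw [lyapunov, quadLyapunov, hu, κν]
  change _ ≤ 1 / 2 * stackedForm (centerMat n) x₀ x₀
    + 1 / 2 * ((S.β + S.γ) / S.γ * stackedForm (S.dualMat lam) w w)
    + stackedForm (centerMat n * S.dualMat lam) x₀ w
    + 1 / (2 * S.ν) * (n * ‖gradient S.F (avg x₀)‖ ^ 2)
  change _ + n * (S.F (avg x₀) - S.fStar) ≤ _
  rw [h1, h2]
  linarith

lemma Invariant.init (hn : 2 ≤ n) (hc : S.LocallyBounded) (hg : S.UndirectedConnected)
    (hPL : S.PolyakLojasiewicz) (hS : S.Gains) {ψ₅ : ℝ} (hψ : 0 < ψ₅) {lam : ℝ}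
    (hlam : 0 < lam) (x₀ : Fin n → Vec d) {s₀ : ℝ}
    (h1 : √(S.κν lam x₀ / (n * S.dTilde ^ 2 * ψ₅ * S.C ^ 2)) ≤ s₀)
    (h2 : (⨆ i, lpNorm S.p (x₀ i)) / S.C ≤ s₀) :
    S.Invariant ψ₅ lam s₀ { x := x₀, v := 0, xhat := 0, y := 0 } := by
  have hC := hc.C_pos
  have hD : 0 < n * S.dTilde ^ 2 * ψ₅ * S.C ^ 2 := by
    have := hS.n_pos
    have := hS.dTilde_pos
    positivity
  refine ⟨?_, ?_, ?_, fun i => ?_⟩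
  · simp
  · simp [avg]
  · refine (lyapunov_init_le hn hg hPL hS hlam x₀).trans ?_
    have h3 := (Real.sqrt_le_iff.1 h1).2
    rw [div_le_iff₀ hD] at h3
    linarith
  · rw [div_le_iff₀ hC] at h2
    have h3 : lpNorm S.p (x₀ i) ≤ ⨆ i, lpNorm S.p (x₀ i) :=
      le_ciSup (f := fun i => lpNorm S.p (x₀ i)) (Set.finite_range _).bddAbove i
    simp only [Pi.zero_apply, sub_zero]
    linarith

/-- The consensus part of the gap has coefficient `ε₁` in the lower bound for `V` and the cost part
has `1 ≥ ε₁`, hence the division by `ε₁`. -/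
lemma Invariant.gap_le (hn : 2 ≤ n) (hg : S.UndirectedConnected) (hopt : S.FiniteOptimum)
    (hS : S.Gains) {ψ₅ lam s : ℝ} {z : State n d} (hz : S.Invariant ψ₅ lam s z) :
    S.gap z.x ≤ S.dTilde ^ 2 * ψ₅ * S.C ^ 2 / S.ε₁ * s ^ 2 := by
  have hV := (S.le_lyapunov hn hg hS lam (stack z.x) (stack z.v)).trans hz.lyapunov_le
  have hW := S.inner_kron_L_nonneg hg (S.dualVec lam (stack z.x) (stack z.v))
  have hf : 0 ≤ n * (S.F (avg z.x) - S.fStar) :=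
    mul_nonneg hS.n_pos.le (sub_nonneg.2 (S.fStar_le hopt _))
  have hn0 := hS.n_pos
  have hε := hS.ε₁_pos
  have hX : ‖kron d (centerMat n) (stack z.x)‖ ^ 2 = ∑ i, ‖z.x i - avg z.x‖ ^ 2 := by
    rw [PiLp.norm_sq_eq_of_L2]
    exact Finset.sum_congr rfl fun i _ => by rw [kron_centerMat_apply]
  rw [hX] at hV
  have h1 := mul_le_mul_of_nonneg_right hS.ε₁_le hf
  have h2 := mul_nonneg hε.le hW
  have h3 : S.ε₁ * (n * S.gap z.x) ≤ n * S.dTilde ^ 2 * ψ₅ * S.C ^ 2 * s ^ 2 := by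
    have e : n * S.gap z.x = n * (S.F (avg z.x) - S.fStar) + ∑ i, ‖z.x i - avg z.x‖ ^ 2 := by
      unfold gap; field_simp
    rw [e]
    have h4 : S.ε₁ * (∑ i, ‖z.x i - avg z.x‖ ^ 2 + inner ℝ
      (S.dualVec lam (stack z.x) (stack z.v)) (kron d S.L (S.dualVec lam (stack z.x) (stack z.v))))
      + n * (S.F (avg z.x) - S.fStar) ≤ n * S.dTilde ^ 2 * ψ₅ * S.C ^ 2 * s ^ 2 := hV
    linarith
  have h5 : n * (S.ε₁ * S.gap z.x) ≤ n * (S.dTilde ^ 2 * ψ₅ * S.C ^ 2 * s ^ 2) := by linarith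
  have h6 := le_of_mul_le_mul_left h5 hn0
  rw [div_mul_eq_mul_div, le_div_iff₀ hε]
  linarith

lemma gap_nonneg (hopt : S.FiniteOptimum) (x : Fin n → Vec d) : 0 ≤ S.gap x := by
  have := S.fStar_le hopt (avg x)
  unfold gap
  have h2 : 0 ≤ 1 / (n : ℝ) * ∑ i, ‖x i - avg x‖ ^ 2 := by positivity
  linarith

lemma run_isBigO (hn : 2 ≤ n) (hc : S.LocallyBounded) (hg : S.UndirectedConnected)
    (hs : S.Smooth) (hopt : S.FiniteOptimum) (hPL : S.PolyakLojasiewicz) (hS : S.Gains)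
    (hω : 0 < S.ω) (hω' : S.ω ≤ 1 / S.r) {α ψ₅ : ℝ} (ha : S.Admissible α ψ₅) {lam : ℝ}
    (hlam : 0 < lam) {ε : ℝ} (hε9 : S.κ₉ α ψ₅ < ε) (hε10 : S.κ₁₀ α ψ₅ < ε)
    (x₀ : Fin n → Vec d) {s₀ : ℝ} (hs₀ : 0 < s₀)
    (h1 : √(S.κν lam x₀ / (n * S.dTilde ^ 2 * ψ₅ * S.C ^ 2)) ≤ s₀)
    (h2 : (⨆ i, lpNorm S.p (x₀ i)) / S.C ≤ s₀) :
    (fun k : ℕ => S.gap (S.run α (fun k => s₀ * ε ^ k) x₀ k).x)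
      =O[Filter.atTop] (fun k : ℕ => ε ^ (2 * k)) := by
  have hε0 : 0 < ε := (Real.sqrt_nonneg _).trans_lt hε9
  have hinv : ∀ k, S.Invariant ψ₅ lam (s₀ * ε ^ k) (S.run α (fun k => s₀ * ε ^ k) x₀ k) := by
    intro k
    induction k with
    | zero =>
      rw [pow_zero, mul_one]
      exact Invariant.init hn hc hg hPL hS (ha.ψ₅_pos hS) hlam x₀ h1 h2
    | succ k ih =>
      have := ih.step hn hc hg hs hopt hPL hS hω hω' ha hlam hε9 hε10 (by positivity)
      rw [mul_assoc, ← pow_succ] at this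
      exact this
  refine Asymptotics.IsBigO.of_bound (S.dTilde ^ 2 * ψ₅ * S.C ^ 2 / S.ε₁ * s₀ ^ 2)
    (Filter.Eventually.of_forall fun k => ?_)
  rw [Real.norm_eq_abs, Real.norm_eq_abs, abs_of_nonneg (gap_nonneg hopt _),
    abs_of_nonneg (by positivity)]
  refine ((hinv k).gap_le hn hg hopt hS).trans (le_of_eq ?_)
  ring

end Setting

end UnifiedCompression

end

theorem theorem3 {n d : ℕ} (hn : 2 ≤ n) (hd : 1 ≤ d)
    (S : UnifiedCompression.Setting n d)
    (hcomp : S.LocallyBounded) (hgraph : S.UndirectedConnected) (hsmooth : S.Smooth)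
    (hopt : S.FiniteOptimum) (hPL : S.PolyakLojasiewicz)
    (hτ : S.κ₁ < S.τ₁) (hγ : S.κ₂ < S.γ) (hω : 0 < S.ω) (hω' : S.ω ≤ 1 / S.r) :
    (S.κ₂' < S.γ →
      ∃ ψ₅ αMax : ℝ, 0 < αMax ∧ ∀ α : ℝ, 0 < α → α < αMax → S.Admissible α ψ₅) ∧
    ∀ α ψ₅ : ℝ, S.Admissible α ψ₅ →
      max (S.κ₉ α ψ₅) (S.κ₁₀ α ψ₅) < 1 ∧
      ∀ (ε : ℝ), max (S.κ₉ α ψ₅) (S.κ₁₀ α ψ₅) < ε → ε < 1 →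
      ∀ (lam : ℝ), S.ρ₂ ≤ lam → lam ≤ S.ρ →
      ∀ (x₀ : Fin n → UnifiedCompression.Vec d) (s₀ : ℝ), 0 < s₀ →
        max (√(S.κν lam x₀ / (n * S.dTilde ^ 2 * ψ₅ * S.C ^ 2)))
          ((⨆ i, UnifiedCompression.lpNorm S.p (x₀ i)) / S.C) ≤ s₀ →
        (fun k : ℕ => S.gap (S.run α (fun k => s₀ * ε ^ k) x₀ k).x)
          =O[Filter.atTop] (fun k : ℕ => ε ^ (2 * k)) := by
  have hS := S.gains hn hd hcomp hgraph hsmooth hPL hτ hγ hω hω'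
  refine ⟨fun hγ' => hS.exists_admissible hγ', fun α ψ₅ ha =>
    ⟨max_lt (ha.κ₉_lt_one hS) (ha.κ₁₀_lt_one hS), ?_⟩⟩
  intro ε hε _ lam hlam _ x₀ s₀ hs₀ hmax
  obtain ⟨hε9, hε10⟩ := max_lt_iff.1 hε
  obtain ⟨h1, h2⟩ := max_le_iff.1 hmax
  exact UnifiedCompression.Setting.run_isBigO hn hcomp hgraph hsmooth hopt hPL hS hω hω' ha
    (hS.ρ₂_pos.trans_le hlam) hε9 hε10 x₀ hs₀ h1 h2
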